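/- Let $k$ be a field and $k(s)$ the field of rational functions in one variable $s$ over $k$. A PROP is a strict symmetric monoidal category whose objects are the natural numbers, with $\oplus$ given on objects by addition; a PROP morphism is a strict symmetric monoidal functor which is the identity on objects. For a field $K$, $\mathrm{FinVect}_K$ is the PROP of linear maps $K^m\to K^n$, and $\mathrm{FinRel}_K$ is the PROP of linear relations $K^m\nrightarrow K^n$ (linear subspaces of $K^m\oplus K^n$), both with direct sum; $i\colon \mathrm{FinVect}_K\to\mathrm{FinRel}_K$ sends a linear map to its graph. **Signal-flow diagrams.** $\mathrm{SigFlow}_k$ is the free PROP on generators $+\colon 2\to 1$, $0\colon 0\to 1$, $\Delta\colon 1\to 2$, $!\colon 1\to 0$, $\cup\colon 2\to 0$, $\cap\colon 0\to 2$ and $s_c\colon 1\to 1$ $(c\in k)$, and $\mathrm{SigFlow}_{k,s}$ is the free PROP on these generators together with one more, the integrator $\int\colon 1\to 1$. The black-box morphisms $\blacksquare\colon\mathrm{SigFlow}_k\to\mathrm{FinRel}_k$ and $\blacksquare\colon\mathrm{SigFlow}_{k,s}\to\mathrm{FinRel}_{k(s)}$ are the PROP morphisms sending $+,0,\Delta,!,s_c$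 to the graphs of $(x,y)\mapsto x+y$, of the zero vector, of $x\mapsto(x,x)$, of the map to the zero space and of $x\mapsto cx$, sending $\cup$ and $\cap$ to the relations $\{((x,x),\ast)\}$ and $\{(\ast,(x,x))\}$, and (in the second case) sending $\int$ to scaling by $1/s$. **Extracted relations.** Let $f\colon m\to p$ in $\mathrm{SigFlow}_{k,s}$ have $n$ integrators. Cutting out all the integrators, turn the $n$ wires that left them into additional inputs and the $n$ wires that entered them into additional outputs (numbered in the same way); this gives a diagram $\hat f\colon m+n\to p+n$ in $\mathrm{SigFlow}_k$. Put $$A(f)=\blacksquare\big((!^p\oplus 1_n)\circ\hat f\circ(0^m\oplus 1_n)\big)\colon k^n\nrightarrow k^n,\qquad B(f)=\blacksquare\big((!^p\oplus 1_n)\circ\hat f\circ(1_m\oplus 0^n)\big)\colon k^m\nrightarrow k^n,$$ $$C(f)=\blacksquare\big((1_p\oplus\,!^n)\circ\hat f\circ(0^m\oplus 1_n)\big)\colon k^n\nrightarrow k^p,$$ and let $D(f)\colon k^m\nrightarrow k^p$ be the black box of the diagram obtained from $f$ by replacing every integrator by $s_0$. (Renumbering the integrators changes $A,B,C$ only by simultaneous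 permutation of the coordinates of $k^n$.) $\mathrm{ContFlow}_k$ consists of those $f$ in $\mathrm{SigFlow}_{k,s}$ for which $A(f),B(f),C(f),D(f)$ are all (graphs of) linear maps. **Stateful morphisms.** For a field $K$, the PROP $\square(\mathrm{FinVect}_K)$ has as morphisms $m\to p$ the quadruples $(d,c,a,b)$ of linear maps $d\colon K^m\to K^p$, $b\colon K^m\to K^\sigma$, $a\colon K^\sigma\to K^\tau$, $c\colon K^\tau\to K^p$, with $\sigma,\tau\in\mathbb N$ arbitrary, modulo $(d,c,a,b)\sim(d,c\,\omega^{-1},\omega a\alpha^{-1},\alpha b)$ for linear isomorphisms $\alpha,\omega$. The morphism $(d,c,a,b)$ followed by $(d',c',a',b')$ is $$\left(d'd,\ [\,d'c\ \ c'\,],\ \begin{bmatrix}a&0\\a'b'ca&a'\end{bmatrix},\ \begin{bmatrix}b\\b'd\end{bmatrix}\right),$$ the monoidal product is componentwise direct sum, and identities and symmetries are $(d,0,0,0)$ with $\sigma=\tau=0$ and $d$ an identity or symmetry of $\mathrm{FinVect}_K$. $\mathrm{Stateful}_k$ is the subPROP of $\square(\mathrm{FinVect}_{k(s)})$ of the morphisms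 of the form $(D,C,(sI-A)^{-1},B)$ with $A\colon k^n\to k^n$, $B\colon k^m\to k^n$, $C\colon k^n\to k^p$, $D\colon k^m\to k^p$ linear over $k$ (extended to $k(s)$). The PROP morphism $\mathrm{eval}\colon\mathrm{Stateful}_k\to\mathrm{FinVect}_{k(s)}$ is $(d,c,a,b)\mapsto d+cab$. **Theorem.** $\mathrm{ContFlow}_k$ is a subPROP of $\mathrm{SigFlow}_{k,s}$: it contains all identities and symmetries and is closed under composition and $\oplus$. The assignment $$\lozenge\colon\mathrm{ContFlow}_k\to\mathrm{Stateful}_k,\qquad f\mapsto\big(D(f),\,C(f),\,(sI-A(f))^{-1},\,B(f)\big)$$ is a well-defined PROP morphism. With $j\colon\mathrm{ContFlow}_k\hookrightarrow\mathrm{SigFlow}_{k,s}$ the inclusion, $\blacksquare\circ j=i\circ\mathrm{eval}\circ\lozenge$; that is, for every $f$ in $\mathrm{ContFlow}_k$ the relation $\blacksquare f$ is the graph of the linear map $D(f)+C(f)\,(sI-A(f))^{-1}B(f)$ over $k(s)$. -/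

import Mathlib

universe u

namespace SignalFlow

noncomputable section

/-! ### PROPs and their morphisms -/

/-- Transport of a morphism along equalities of its source and its target. -/
def castHom {H : ℕ → ℕ → Type u} {m m' n n' : ℕ} (hm : m = m') (hn : n = n') (f : H m n) :
    H m' n' :=
  cast (by rw [hm, hn]) f

theorem castHom_rfl {H : ℕ → ℕ → Type u} {m n : ℕ} (hm : m = m) (hn : n = n) (f : H m n) :
    castHom hm hn f = f := rfl

/-- A PROP: a strict symmetric monoidal category whose objects are the natural numbers and whose
monoidal product is addition on objects.  Composition is written in diagrammatic order: `comp f g`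
is `f` followed by `g`, that is `g ∘ f`.  The laws whose two sides only have the same type up to
an equality in `ℕ` are stated with `castHom`. -/
structure PROP where
  /-- morphisms -/
  Hom : ℕ → ℕ → Type u
  /-- identities -/
  id : ∀ n, Hom n n
  /-- composition -/
  comp : ∀ {l m n}, Hom l m → Hom m n → Hom l n
  /-- monoidal product -/
  tensor : ∀ {m n m' n'}, Hom m n → Hom m' n' → Hom (m + m') (n + n')
  /-- symmetry -/
  braid : ∀ m n, Hom (m + n) (n + m)
  id_comp : ∀ {m n} (f : Hom m n), comp (id m) f = f
  comp_id : ∀ {m n} (f : Hom m n), comp f (id n) = f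
  assoc : ∀ {l m n p} (f : Hom l m) (g : Hom m n) (h : Hom n p),
    comp (comp f g) h = comp f (comp g h)
  tensor_id : ∀ m n, tensor (id m) (id n) = id (m + n)
  tensor_comp : ∀ {l m n l' m' n'} (f : Hom l m) (g : Hom m n) (f' : Hom l' m') (g' : Hom m' n'),
    tensor (comp f g) (comp f' g') = comp (tensor f f') (tensor g g')
  tensor_assoc : ∀ {m n m' n' m'' n''} (f : Hom m n) (g : Hom m' n') (h : Hom m'' n''),
    castHom (add_assoc m m' m'') (add_assoc n n' n'') (tensor (tensor f g) h)
      = tensor f (tensor g h)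
  id_zero_tensor : ∀ {m n} (f : Hom m n),
    castHom (zero_add m) (zero_add n) (tensor (id 0) f) = f
  tensor_id_zero : ∀ {m n} (f : Hom m n),
    castHom (add_zero m) (add_zero n) (tensor f (id 0)) = f
  braid_natural : ∀ {m n m' n'} (f : Hom m n) (g : Hom m' n'),
    comp (tensor f g) (braid n n') = comp (braid m m') (tensor g f)
  braid_braid : ∀ m n, comp (braid m n) (braid n m) = id (m + n)
  hexagon : ∀ m n p,
    comp (castHom (add_assoc m n p) rfl (tensor (braid m n) (id p)))
      (castHom (add_assoc n m p).symm (add_assoc n p m).symm (tensor (id n) (braid m p)))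
      = braid m (n + p)

/-- A morphism of PROPs: a strict symmetric monoidal functor that maps the object `1` to the
object `1`, hence is the identity on objects. -/
@[ext]
structure PROPHom (P Q : PROP.{u}) where
  /-- the action on morphisms -/
  map : ∀ {m n}, P.Hom m n → Q.Hom m n
  map_id : ∀ n, map (P.id n) = Q.id n
  map_comp : ∀ {l m n} (f : P.Hom l m) (g : P.Hom m n), map (P.comp f g) = Q.comp (map f) (map g)
  map_tensor : ∀ {m n m' n'} (f : P.Hom m n) (g : P.Hom m' n'),
    map (P.tensor f g) = Q.tensor (map f) (map g)
  map_braid : ∀ m n, map (P.braid m n) = Q.braid m n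

/-- Composition of morphisms of PROPs (`F` followed by `G`). -/
def PROPHom.trans {P Q R : PROP.{u}} (F : PROPHom P Q) (G : PROPHom Q R) : PROPHom P R where
  map f := G.map (F.map f)
  map_id n := by rw [F.map_id, G.map_id]
  map_comp f g := by rw [F.map_comp, G.map_comp]
  map_tensor f g := by rw [F.map_tensor, G.map_tensor]
  map_braid m n := by rw [F.map_braid, G.map_braid]

/-- A class of morphisms of a PROP is closed when it contains the identities and the symmetries
and is closed under composition and monoidal product. -/
structure PROP.IsClosed (P : PROP.{u}) (S : ∀ m n, Set (P.Hom m n)) : Prop where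
  id_mem : ∀ n, P.id n ∈ S n n
  comp_mem : ∀ {l m n} {f : P.Hom l m} {g : P.Hom m n}, f ∈ S l m → g ∈ S m n → P.comp f g ∈ S l n
  tensor_mem : ∀ {m n m' n'} {f : P.Hom m n} {g : P.Hom m' n'}, f ∈ S m n → g ∈ S m' n' →
    P.tensor f g ∈ S (m + m') (n + n')
  braid_mem : ∀ m n, P.braid m n ∈ S (m + n) (n + m)

theorem castHom_val {P : PROP.{u}} {S : ∀ m n, Set (P.Hom m n)} {m n m' n' : ℕ}
    (hm : m = m') (hn : n = n') (f : S m n) :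
    (castHom (H := fun m n => ↥(S m n)) hm hn f).1 = castHom hm hn f.1 := by
  subst hm hn; rfl

/-- The subPROP carried by a closed class of morphisms. -/
def PROP.sub (P : PROP.{u}) (S : ∀ m n, Set (P.Hom m n)) (h : P.IsClosed S) : PROP.{u} where
  Hom m n := ↥(S m n)
  id n := ⟨P.id n, h.id_mem n⟩
  comp f g := ⟨P.comp f.1 g.1, h.comp_mem f.2 g.2⟩
  tensor f g := ⟨P.tensor f.1 g.1, h.tensor_mem f.2 g.2⟩
  braid m n := ⟨P.braid m n, h.braid_mem m n⟩
  id_comp f := Subtype.ext (P.id_comp f.1)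
  comp_id f := Subtype.ext (P.comp_id f.1)
  assoc f g h := Subtype.ext (P.assoc f.1 g.1 h.1)
  tensor_id m n := Subtype.ext (P.tensor_id m n)
  tensor_comp f g f' g' := Subtype.ext (P.tensor_comp f.1 g.1 f'.1 g'.1)
  tensor_assoc f g h := Subtype.ext ((castHom_val _ _ _).trans (P.tensor_assoc f.1 g.1 h.1))
  id_zero_tensor f := Subtype.ext ((castHom_val _ _ _).trans (P.id_zero_tensor f.1))
  tensor_id_zero f := Subtype.ext ((castHom_val _ _ _).trans (P.tensor_id_zero f.1))
  braid_natural f g := Subtype.ext (P.braid_natural f.1 g.1)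
  braid_braid m n := Subtype.ext (P.braid_braid m n)
  hexagon m n p := Subtype.ext <| by
    simp only [castHom_val]
    exact P.hexagon m n p

/-- The inclusion of a subPROP. -/
def PROP.incl (P : PROP.{u}) (S : ∀ m n, Set (P.Hom m n)) (h : P.IsClosed S) :
    PROPHom (P.sub S h) P where
  map f := f.1
  map_id _ := rfl
  map_comp _ _ := rfl
  map_tensor _ _ := rfl
  map_braid _ _ := rfl

/-! ### Free PROPs -/

/-- Terms over a signature `Sg`: formal composites and monoidal products of identities,
symmetries and the symbols of `Sg`. -/
inductive Term (Sg : ℕ → ℕ → Type u) : ℕ → ℕ → Type u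
  | id (n : ℕ) : Term Sg n n
  | braid (m n : ℕ) : Term Sg (m + n) (n + m)
  | gen {m n : ℕ} (g : Sg m n) : Term Sg m n
  | comp {l m n : ℕ} (f : Term Sg l m) (g : Term Sg m n) : Term Sg l n
  | tensor {m n m' n' : ℕ} (f : Term Sg m n) (g : Term Sg m' n') : Term Sg (m + m') (n + n')

/-- The congruence on terms generated by the laws of a PROP. -/
inductive Term.Rel {Sg : ℕ → ℕ → Type u} : ∀ {m n : ℕ}, Term Sg m n → Term Sg m n → Prop
  | refl {m n} (f : Term Sg m n) : Rel f f
  | symm {m n} {f g : Term Sg m n} : Rel f g → Rel g f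
  | trans {m n} {f g h : Term Sg m n} : Rel f g → Rel g h → Rel f h
  | comp {l m n} {f f' : Term Sg l m} {g g' : Term Sg m n} :
      Rel f f' → Rel g g' → Rel (.comp f g) (.comp f' g')
  | tensor {m n m' n'} {f f' : Term Sg m n} {g g' : Term Sg m' n'} :
      Rel f f' → Rel g g' → Rel (.tensor f g) (.tensor f' g')
  | id_comp {m n} (f : Term Sg m n) : Rel (.comp (.id m) f) f
  | comp_id {m n} (f : Term Sg m n) : Rel (.comp f (.id n)) f
  | assoc {l m n p} (f : Term Sg l m) (g : Term Sg m n) (h : Term Sg n p) :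
      Rel (.comp (.comp f g) h) (.comp f (.comp g h))
  | tensor_id (m n) : Rel (.tensor (.id m) (.id n)) (.id (m + n))
  | tensor_comp {l m n l' m' n'} (f : Term Sg l m) (g : Term Sg m n) (f' : Term Sg l' m')
      (g' : Term Sg m' n') :
      Rel (.tensor (.comp f g) (.comp f' g')) (.comp (.tensor f f') (.tensor g g'))
  | tensor_assoc {m n m' n' m'' n''} (f : Term Sg m n) (g : Term Sg m' n') (h : Term Sg m'' n'') :
      Rel (castHom (add_assoc m m' m'') (add_assoc n n' n'') (.tensor (.tensor f g) h))
        (.tensor f (.tensor g h))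
  | id_zero_tensor {m n} (f : Term Sg m n) :
      Rel (castHom (zero_add m) (zero_add n) (.tensor (.id 0) f)) f
  | tensor_id_zero {m n} (f : Term Sg m n) :
      Rel (castHom (add_zero m) (add_zero n) (.tensor f (.id 0))) f
  | braid_natural {m n m' n'} (f : Term Sg m n) (g : Term Sg m' n') :
      Rel (.comp (.tensor f g) (.braid n n')) (.comp (.braid m m') (.tensor g f))
  | braid_braid (m n) : Rel (.comp (.braid m n) (.braid n m)) (.id (m + n))
  | hexagon (m n p) :
      Rel (.comp (castHom (add_assoc m n p) rfl (.tensor (.braid m n) (.id p)))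
        (castHom (add_assoc n m p).symm (add_assoc n p m).symm (.tensor (.id n) (.braid m p))))
        (.braid m (n + p))

/-- Terms up to the laws of a PROP. -/
def termSetoid (Sg : ℕ → ℕ → Type u) (m n : ℕ) : Setoid (Term Sg m n) where
  r := Term.Rel
  iseqv := ⟨Term.Rel.refl, Term.Rel.symm, Term.Rel.trans⟩

/-- Morphisms of the free PROP. -/
def FreeHom (Sg : ℕ → ℕ → Type u) (m n : ℕ) : Type u := Quotient (termSetoid Sg m n)

/-- The morphism of the free PROP that a term denotes. -/
def Term.mk {Sg : ℕ → ℕ → Type u} {m n : ℕ} (t : Term Sg m n) : FreeHom Sg m n :=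
  Quotient.mk (termSetoid Sg m n) t

theorem Term.mk_sound {Sg : ℕ → ℕ → Type u} {m n : ℕ} {t t' : Term Sg m n} (h : Term.Rel t t') :
    t.mk = t'.mk :=
  Quotient.sound (s := termSetoid Sg m n) h

theorem Term.mk_cast {Sg : ℕ → ℕ → Type u} {m n m' n' : ℕ} (hm : m = m') (hn : n = n')
    (t : Term Sg m n) :
    castHom (H := FreeHom Sg) hm hn t.mk = (castHom hm hn t).mk := by
  subst hm hn; rfl

/-- Composition in the free PROP. -/
def FreeHom.comp {Sg : ℕ → ℕ → Type u} {l m n : ℕ} (f : FreeHom Sg l m) (g : FreeHom Sg m n) :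
    FreeHom Sg l n :=
  Quotient.lift₂ (s₁ := termSetoid Sg l m) (s₂ := termSetoid Sg m n)
    (fun s t => (Term.comp s t).mk)
    (fun _ _ _ _ h h' => Term.mk_sound (Term.Rel.comp h h')) f g

/-- Monoidal product in the free PROP. -/
def FreeHom.tensor {Sg : ℕ → ℕ → Type u} {m n m' n' : ℕ} (f : FreeHom Sg m n)
    (g : FreeHom Sg m' n') : FreeHom Sg (m + m') (n + n') :=
  Quotient.lift₂ (s₁ := termSetoid Sg m n) (s₂ := termSetoid Sg m' n')
    (fun s t => (Term.tensor s t).mk)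
    (fun _ _ _ _ h h' => Term.mk_sound (Term.Rel.tensor h h')) f g

theorem FreeHom.ind {Sg : ℕ → ℕ → Type u} {m n : ℕ} {p : FreeHom Sg m n → Prop}
    (h : ∀ t : Term Sg m n, p t.mk) (f : FreeHom Sg m n) : p f :=
  Quotient.ind (s := termSetoid Sg m n) h f

/-- The free PROP on a signature. -/
def Free (Sg : ℕ → ℕ → Type u) : PROP.{u} where
  Hom := FreeHom Sg
  id n := (Term.id n).mk
  comp := FreeHom.comp
  tensor := FreeHom.tensor
  braid m n := (Term.braid m n).mk
  id_comp := fun f => by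
    induction f using FreeHom.ind with | h f => exact Term.mk_sound (.id_comp f)
  comp_id := fun f => by
    induction f using FreeHom.ind with | h f => exact Term.mk_sound (.comp_id f)
  assoc := fun f g h => by
    induction f using FreeHom.ind with | h f =>
    induction g using FreeHom.ind with | h g =>
    induction h using FreeHom.ind with | h h =>
    exact Term.mk_sound (.assoc f g h)
  tensor_id m n := Term.mk_sound (.tensor_id m n)
  tensor_comp := fun f g f' g' => by
    induction f using FreeHom.ind with | h f =>
    induction g using FreeHom.ind with | h g =>
    induction f' using FreeHom.ind with | h f' =>
    induction g' using FreeHom.ind with | h g' =>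
    exact Term.mk_sound (.tensor_comp f g f' g')
  tensor_assoc := fun f g h => by
    induction f using FreeHom.ind with | h f =>
    induction g using FreeHom.ind with | h g =>
    induction h using FreeHom.ind with | h h =>
    exact (Term.mk_cast _ _ _).trans (Term.mk_sound (.tensor_assoc f g h))
  id_zero_tensor := fun f => by
    induction f using FreeHom.ind with | h f =>
    exact (Term.mk_cast _ _ _).trans (Term.mk_sound (.id_zero_tensor f))
  tensor_id_zero := fun f => by
    induction f using FreeHom.ind with | h f =>
    exact (Term.mk_cast _ _ _).trans (Term.mk_sound (.tensor_id_zero f))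
  braid_natural := fun f g => by
    induction f using FreeHom.ind with | h f =>
    induction g using FreeHom.ind with | h g =>
    exact Term.mk_sound (.braid_natural f g)
  braid_braid m n := Term.mk_sound (.braid_braid m n)
  hexagon m n p := by
    refine Eq.trans ?_ (Term.mk_sound (.hexagon m n p))
    refine Eq.trans (congrArg₂ FreeHom.comp (Term.mk_cast _ _ (.tensor (.braid m n) (.id p)))
      (Term.mk_cast _ _ (.tensor (.id n) (.braid m p)))) rfl

/-- The value of a term in a PROP, given values of the symbols. -/
def Term.eval {Sg : ℕ → ℕ → Type u} (P : PROP.{u}) (v : ∀ {m n}, Sg m n → P.Hom m n) :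
    ∀ {m n : ℕ}, Term Sg m n → P.Hom m n
  | _, _, .id n => P.id n
  | _, _, .braid m n => P.braid m n
  | _, _, .gen g => v g
  | _, _, .comp f g => P.comp (f.eval P v) (g.eval P v)
  | _, _, .tensor f g => P.tensor (f.eval P v) (g.eval P v)

theorem Term.eval_cast {Sg : ℕ → ℕ → Type u} (P : PROP.{u}) (v : ∀ {m n}, Sg m n → P.Hom m n)
    {m n m' n' : ℕ} (hm : m = m') (hn : n = n') (t : Term Sg m n) :
    (castHom hm hn t).eval P v = castHom hm hn (t.eval P v) := by
  subst hm hn; rfl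

theorem Term.eval_sound {Sg : ℕ → ℕ → Type u} (P : PROP.{u})
    (v : ∀ {m n}, Sg m n → P.Hom m n) {m n : ℕ} {s t : Term Sg m n} (h : Term.Rel s t) :
    s.eval P v = t.eval P v := by
  induction h with
  | refl => rfl
  | symm _ ih => exact ih.symm
  | trans _ _ ih ih' => exact ih.trans ih'
  | comp _ _ ih ih' => simp only [Term.eval, ih, ih']
  | tensor _ _ ih ih' => simp only [Term.eval, ih, ih']
  | id_comp f => exact P.id_comp _
  | comp_id f => exact P.comp_id _
  | assoc f g h => exact P.assoc _ _ _
  | tensor_id m n => exact P.tensor_id m n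
  | tensor_comp f g f' g' => exact P.tensor_comp _ _ _ _
  | tensor_assoc f g h => rw [Term.eval_cast]; exact P.tensor_assoc _ _ _
  | id_zero_tensor f => rw [Term.eval_cast]; exact P.id_zero_tensor _
  | tensor_id_zero f => rw [Term.eval_cast]; exact P.tensor_id_zero _
  | braid_natural f g => exact P.braid_natural _ _
  | braid_braid m n => exact P.braid_braid m n
  | hexagon m n p =>
    simp only [Term.eval, Term.eval_cast]
    exact P.hexagon m n p

/-- The morphism from a free PROP determined by values of the symbols. -/
def Free.lift {Sg : ℕ → ℕ → Type u} (P : PROP.{u}) (v : ∀ {m n}, Sg m n → P.Hom m n) :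
    PROPHom (Free Sg) P where
  map f := Quotient.lift (s := termSetoid Sg _ _) (fun t => t.eval P v)
    (fun _ _ h => Term.eval_sound P v h) f
  map_id _ := rfl
  map_comp f g := by
    induction f using FreeHom.ind with | h f =>
    induction g using FreeHom.ind with | h g => rfl
  map_tensor f g := by
    induction f using FreeHom.ind with | h f =>
    induction g using FreeHom.ind with | h g => rfl
  map_braid _ _ := rfl

/-! ### Linear maps and linear relations -/

section Linear

variable {K : Type u} [Field K]

/-- First block of a vector. -/
def fstL (K : Type u) [Field K] (m n : ℕ) : (Fin (m + n) → K) →ₗ[K] (Fin m → K) :=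
  LinearMap.funLeft K K (Fin.castAdd n)

/-- Second block of a vector. -/
def sndL (K : Type u) [Field K] (m n : ℕ) : (Fin (m + n) → K) →ₗ[K] (Fin n → K) :=
  LinearMap.funLeft K K (Fin.natAdd m)

/-- The linear map into `K ^ (m + n) = K ^ m ⊕ K ^ n` with the given components. -/
def pairL {V : Type u} [AddCommGroup V] [Module K V] {m n : ℕ} (f : V →ₗ[K] (Fin m → K))
    (g : V →ₗ[K] (Fin n → K)) : V →ₗ[K] (Fin (m + n) → K) :=
  LinearMap.pi (Fin.addCases (fun i => LinearMap.proj i ∘ₗ f) (fun j => LinearMap.proj j ∘ₗ g))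

@[simp] theorem fstL_pairL {V : Type u} [AddCommGroup V] [Module K V] {m n : ℕ}
    (f : V →ₗ[K] (Fin m → K)) (g : V →ₗ[K] (Fin n → K)) (x : V) :
    fstL K m n (pairL f g x) = f x := by
  ext i; simp [fstL, pairL, LinearMap.funLeft_apply]

@[simp] theorem sndL_pairL {V : Type u} [AddCommGroup V] [Module K V] {m n : ℕ}
    (f : V →ₗ[K] (Fin m → K)) (g : V →ₗ[K] (Fin n → K)) (x : V) :
    sndL K m n (pairL f g x) = g x := by
  ext i; simp [sndL, pairL, LinearMap.funLeft_apply]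

theorem vec_ext {m n : ℕ} {x y : Fin (m + n) → K} (h : fstL K m n x = fstL K m n y)
    (h' : sndL K m n x = sndL K m n y) : x = y := by
  ext i
  induction i using Fin.addCases with
  | left i => exact congrFun h i
  | right i => exact congrFun h' i

theorem vec_ext_iff {m n : ℕ} {x y : Fin (m + n) → K} :
    x = y ↔ fstL K m n x = fstL K m n y ∧ sndL K m n x = sndL K m n y :=
  ⟨fun h => by simp [h], fun h => vec_ext h.1 h.2⟩

/-- The direct sum of two linear maps. -/
def sumL {m n m' n' : ℕ} (f : (Fin m → K) →ₗ[K] (Fin n → K))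
    (g : (Fin m' → K) →ₗ[K] (Fin n' → K)) : (Fin (m + m') → K) →ₗ[K] (Fin (n + n') → K) :=
  pairL (f ∘ₗ fstL K m m') (g ∘ₗ sndL K m m')

/-- The exchange of blocks `K ^ m ⊕ K ^ n → K ^ n ⊕ K ^ m`. -/
def swapL (K : Type u) [Field K] (m n : ℕ) : (Fin (m + n) → K) →ₗ[K] (Fin (n + m) → K) :=
  pairL (sndL K m n) (fstL K m n)

/-- Renumbering of coordinates along `m = m'`. -/
def castL (K : Type u) [Field K] {m m' : ℕ} (h : m = m') : (Fin m → K) ≃ₗ[K] (Fin m' → K) :=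
  LinearEquiv.funCongrLeft K K (finCongr h.symm)

@[simp] theorem castL_rfl {m : ℕ} (h : m = m) (x : Fin m → K) : castL K h x = x := rfl

@[simp] theorem castL_symm {m m' : ℕ} (h : m = m') : (castL K h).symm = castL K h.symm := rfl

theorem fstL_castL_assoc {a b c : ℕ} (h : a + b + c = a + (b + c)) (x : Fin (a + b + c) → K) :
    fstL K a (b + c) (castL K h x) = fstL K a b (fstL K (a + b) c x) := rfl

theorem fst_sndL_castL_assoc {a b c : ℕ} (h : a + b + c = a + (b + c))
    (x : Fin (a + b + c) → K) :
    fstL K b c (sndL K a (b + c) (castL K h x)) = sndL K a b (fstL K (a + b) c x) := rfl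

theorem snd_sndL_castL_assoc {a b c : ℕ} (h : a + b + c = a + (b + c))
    (x : Fin (a + b + c) → K) :
    sndL K b c (sndL K a (b + c) (castL K h x)) = sndL K (a + b) c x := by
  ext i
  exact congrArg x (Fin.ext (by simp [add_assoc]))

theorem fst_fstL_castL_assoc {a b c : ℕ} (h : a + (b + c) = a + b + c)
    (x : Fin (a + (b + c)) → K) :
    fstL K a b (fstL K (a + b) c (castL K h x)) = fstL K a (b + c) x := rfl

theorem snd_fstL_castL_assoc {a b c : ℕ} (h : a + (b + c) = a + b + c)
    (x : Fin (a + (b + c)) → K) :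
    sndL K a b (fstL K (a + b) c (castL K h x)) = fstL K b c (sndL K a (b + c) x) := rfl

theorem sndL_castL_assoc {a b c : ℕ} (h : a + (b + c) = a + b + c)
    (x : Fin (a + (b + c)) → K) :
    sndL K (a + b) c (castL K h x) = sndL K b c (sndL K a (b + c) x) := by
  ext i
  exact congrArg x (Fin.ext (by simp [add_assoc]))

theorem sndL_zero_add {m : ℕ} (h : 0 + m = m) (x : Fin m → K) :
    sndL K 0 m (castL K h.symm x) = x := by
  ext i
  exact congrArg x (Fin.ext (by simp))

theorem castL_zero_add {m : ℕ} (h : 0 + m = m) (x : Fin (0 + m) → K) :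
    castL K h x = sndL K 0 m x := by
  ext i
  exact congrArg x (Fin.ext (by simp))

theorem fstL_add_zero {m : ℕ} (x : Fin m → K) : fstL K m 0 x = x := rfl

theorem castHom_linear {m n m' n' : ℕ} (hm : m = m') (hn : n = n')
    (f : (Fin m → K) →ₗ[K] (Fin n → K)) (x : Fin m' → K) :
    castHom (H := fun m n => (Fin m → K) →ₗ[K] (Fin n → K)) hm hn f x
      = castL K hn (f (castL K hm.symm x)) := by
  subst hm hn; rfl

/-- The PROP of linear maps `K ^ m → K ^ n`, with direct sum. -/
def FinVect (K : Type u) [Field K] : PROP.{u} where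
  Hom m n := (Fin m → K) →ₗ[K] (Fin n → K)
  id _ := LinearMap.id
  comp f g := g ∘ₗ f
  tensor f g := sumL f g
  braid m n := swapL K m n
  id_comp _ := rfl
  comp_id _ := rfl
  assoc _ _ _ := rfl
  tensor_id m n := by
    refine LinearMap.ext fun x => vec_ext ?_ ?_ <;> simp [sumL]
  tensor_comp f g f' g' := by
    refine LinearMap.ext fun x => vec_ext ?_ ?_ <;> simp [sumL]
  tensor_assoc f g h := by
    refine LinearMap.ext fun x => ?_
    rw [castHom_linear]
    refine vec_ext ?_ (vec_ext ?_ ?_) <;>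
      simp [sumL, fstL_castL_assoc, fst_sndL_castL_assoc, snd_sndL_castL_assoc,
        fst_fstL_castL_assoc, snd_fstL_castL_assoc, sndL_castL_assoc]
  id_zero_tensor f := by
    refine LinearMap.ext fun x => ?_
    rw [castHom_linear, castL_zero_add]
    simp [sumL, sndL_zero_add]
  tensor_id_zero f := by
    refine LinearMap.ext fun x => ?_
    rw [castHom_linear]
    exact fstL_pairL _ _ _
  braid_natural f g := by
    refine LinearMap.ext fun x => vec_ext ?_ ?_ <;> simp [sumL, swapL]
  braid_braid m n := by
    refine LinearMap.ext fun x => vec_ext ?_ ?_ <;> simp [swapL]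
  hexagon m n p := by
    refine LinearMap.ext fun x => ?_
    rw [LinearMap.comp_apply, castHom_linear, castHom_linear]
    refine vec_ext (vec_ext ?_ ?_) ?_ <;>
      simp [sumL, swapL, fstL_castL_assoc, fst_sndL_castL_assoc, snd_sndL_castL_assoc,
        fst_fstL_castL_assoc, snd_fstL_castL_assoc, sndL_castL_assoc]

/-- Composition of linear relations. -/
def relComp {l m n : ℕ} (R : Submodule K ((Fin l → K) × (Fin m → K)))
    (S : Submodule K ((Fin m → K) × (Fin n → K))) :
    Submodule K ((Fin l → K) × (Fin n → K)) where
  carrier := {w | ∃ v, (w.1, v) ∈ R ∧ (v, w.2) ∈ S}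
  zero_mem' := ⟨0, R.zero_mem, S.zero_mem⟩
  add_mem' := by
    rintro w w' ⟨v, h₁, h₂⟩ ⟨v', h₁', h₂'⟩
    exact ⟨v + v', R.add_mem h₁ h₁', S.add_mem h₂ h₂'⟩
  smul_mem' := by
    rintro c w ⟨v, h₁, h₂⟩
    exact ⟨c • v, R.smul_mem c h₁, S.smul_mem c h₂⟩

/-- Direct sum of linear relations. -/
def relSum {m n m' n' : ℕ} (R : Submodule K ((Fin m → K) × (Fin n → K)))
    (S : Submodule K ((Fin m' → K) × (Fin n' → K))) :
    Submodule K ((Fin (m + m') → K) × (Fin (n + n') → K)) where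
  carrier := {w | (fstL K m m' w.1, fstL K n n' w.2) ∈ R ∧ (sndL K m m' w.1, sndL K n n' w.2) ∈ S}
  zero_mem' := by
    constructor
    · rw [Prod.fst_zero, Prod.snd_zero, map_zero, map_zero]; exact R.zero_mem
    · rw [Prod.fst_zero, Prod.snd_zero, map_zero, map_zero]; exact S.zero_mem
  add_mem' := by
    rintro w w' ⟨h₁, h₂⟩ ⟨h₁', h₂'⟩
    constructor
    · simpa using R.add_mem h₁ h₁'
    · simpa using S.add_mem h₂ h₂'
  smul_mem' := by
    rintro c w ⟨h₁, h₂⟩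
    constructor
    · simpa using R.smul_mem c h₁
    · simpa using S.smul_mem c h₂

theorem mem_relComp {l m n : ℕ} {R : Submodule K ((Fin l → K) × (Fin m → K))}
    {S : Submodule K ((Fin m → K) × (Fin n → K))} {u : Fin l → K} {w : Fin n → K} :
    (u, w) ∈ relComp R S ↔ ∃ v, (u, v) ∈ R ∧ (v, w) ∈ S := Iff.rfl

theorem mem_relSum {m n m' n' : ℕ} {R : Submodule K ((Fin m → K) × (Fin n → K))}
    {S : Submodule K ((Fin m' → K) × (Fin n' → K))} {u : Fin (m + m') → K}
    {w : Fin (n + n') → K} :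
    (u, w) ∈ relSum R S ↔ (fstL K m m' u, fstL K n n' w) ∈ R ∧
      (sndL K m m' u, sndL K n n' w) ∈ S := Iff.rfl

theorem mem_graph {m n : ℕ} {f : (Fin m → K) →ₗ[K] (Fin n → K)} {u : Fin m → K}
    {w : Fin n → K} : (u, w) ∈ f.graph ↔ w = f u := LinearMap.mem_graph_iff f _

theorem castHom_rel {m n m' n' : ℕ} (hm : m = m') (hn : n = n')
    (R : Submodule K ((Fin m → K) × (Fin n → K))) (u : Fin m' → K) (w : Fin n' → K) :
    (u, w) ∈ castHom (H := fun m n => Submodule K ((Fin m → K) × (Fin n → K))) hm hn R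
      ↔ (castL K hm.symm u, castL K hn.symm w) ∈ R := by
  subst hm hn; rfl

theorem relComp_graph {l m n : ℕ} (f : (Fin l → K) →ₗ[K] (Fin m → K))
    (g : (Fin m → K) →ₗ[K] (Fin n → K)) : relComp f.graph g.graph = (g ∘ₗ f).graph := by
  ext ⟨u, w⟩; simp [mem_relComp]

theorem relSum_graph {m n m' n' : ℕ} (f : (Fin m → K) →ₗ[K] (Fin n → K))
    (g : (Fin m' → K) →ₗ[K] (Fin n' → K)) : relSum f.graph g.graph = (sumL f g).graph := by
  ext ⟨u, w⟩; simp [mem_relSum, sumL, vec_ext_iff]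

theorem castHom_graph {m n m' n' : ℕ} (hm : m = m') (hn : n = n')
    (f : (Fin m → K) →ₗ[K] (Fin n → K)) :
    castHom (H := fun m n => Submodule K ((Fin m → K) × (Fin n → K))) hm hn f.graph
      = LinearMap.graph
          (castHom (H := fun m n => (Fin m → K) →ₗ[K] (Fin n → K)) hm hn f) := by
  subst hm hn; rfl

/-- The PROP of linear relations `K ^ m ⇸ K ^ n`, that is, linear subspaces of `K ^ m ⊕ K ^ n`,
with the usual composition of relations and with direct sum. -/
def FinRel (K : Type u) [Field K] : PROP.{u} where
  Hom m n := Submodule K ((Fin m → K) × (Fin n → K))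
  id n := (LinearMap.id : (Fin n → K) →ₗ[K] (Fin n → K)).graph
  comp R S := relComp R S
  tensor R S := relSum R S
  braid m n := (swapL K m n).graph
  id_comp R := by ext ⟨u, w⟩; simp [mem_relComp]
  comp_id R := by ext ⟨u, w⟩; simp [mem_relComp]
  assoc R S T := by
    ext ⟨u, w⟩
    simp only [mem_relComp]
    constructor
    · rintro ⟨v, ⟨v', h₁, h₂⟩, h₃⟩
      exact ⟨v', h₁, v, h₂, h₃⟩
    · rintro ⟨v, h₁, v', h₂, h₃⟩
      exact ⟨v', ⟨v, h₁, h₂⟩, h₃⟩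
  tensor_id m n := (relSum_graph _ _).trans (congrArg LinearMap.graph ((FinVect K).tensor_id m n))
  tensor_comp {l m n l' m' n'} R S R' S' := by
    ext ⟨u, w⟩
    simp only [mem_relComp, mem_relSum]
    constructor
    · rintro ⟨⟨v, h₁, h₂⟩, v', h₃, h₄⟩
      refine ⟨pairL (LinearMap.fst K _ _) (LinearMap.snd K _ _) (v, v'), ?_⟩
      simp [h₁, h₂, h₃, h₄]
    · rintro ⟨v, ⟨h₁, h₂⟩, h₃, h₄⟩
      exact ⟨⟨_, h₁, h₃⟩, _, h₂, h₄⟩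
  tensor_assoc R S T := by
    ext ⟨u, w⟩
    rw [castHom_rel]
    simp only [mem_relSum, fst_fstL_castL_assoc, snd_fstL_castL_assoc, sndL_castL_assoc, and_assoc]
  id_zero_tensor R := by
    ext ⟨u, w⟩
    rw [castHom_rel]
    simp [mem_relSum, sndL_zero_add]
    exact fun _ => Subsingleton.elim _ _
  tensor_id_zero R := by
    ext ⟨u, w⟩
    rw [castHom_rel]
    simp only [mem_relSum, fstL_add_zero, mem_graph]
    exact ⟨fun h => h.1, fun h => ⟨h, Subsingleton.elim _ _⟩⟩
  braid_natural {m n m' n'} R S := by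
    ext ⟨u, w⟩
    simp only [mem_relComp, mem_relSum, mem_graph]
    constructor
    · rintro ⟨v, ⟨h₁, h₂⟩, rfl⟩
      exact ⟨_, rfl, by simpa [swapL] using ⟨h₂, h₁⟩⟩
    · rintro ⟨v, rfl, h₁, h₂⟩
      simp only [swapL, fstL_pairL, sndL_pairL] at h₁ h₂
      refine ⟨swapL K n' n w, by simpa [swapL] using And.intro h₂ h₁, ?_⟩
      refine vec_ext ?_ ?_ <;> simp [swapL]
  braid_braid m n := (relComp_graph _ _).trans
    (congrArg LinearMap.graph ((FinVect K).braid_braid m n))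
  hexagon m n p := by
    have h := congrArg LinearMap.graph ((FinVect K).hexagon m n p)
    refine Eq.trans ?_ h
    refine Eq.trans (congrArg₂ relComp ?_ ?_) (relComp_graph _ _)
    · exact Eq.trans (congrArg _ (relSum_graph _ _)) (castHom_graph _ _ _)
    · exact Eq.trans (congrArg _ (relSum_graph _ _)) (castHom_graph _ _ _)

/-- The inclusion of linear maps in linear relations: a linear map is sent to its graph. -/
def graphHom (K : Type u) [Field K] : PROPHom (FinVect K) (FinRel K) where
  map f := LinearMap.graph f
  map_id _ := rfl
  map_comp f g := (relComp_graph f g).symm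
  map_tensor f g := (relSum_graph f g).symm
  map_braid _ _ := rfl

end Linear

/-! ### The Box construction -/

section Box

set_option linter.unusedSimpArgs false

variable {K : Type u} [Field K]

theorem pairL_zero {V : Type u} [AddCommGroup V] [Module K V] {m : ℕ}
    (f : V →ₗ[K] (Fin m → K)) (g : V →ₗ[K] (Fin 0 → K)) (x : V) : pairL f g x = f x :=
  fstL_pairL f g x

/-- A square of linear maps `d : K ^ m → K ^ n`, `b : K ^ m → K ^ s`, `a : K ^ s → K ^ t`,
`c : K ^ t → K ^ n`, abbreviated `(d, c, a, b)`; `K ^ s` is the prestate space and `K ^ t` is the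
state space. -/
structure Square (K : Type u) [Field K] (m n : ℕ) : Type u where
  /-- dimension of the prestate space -/
  s : ℕ
  /-- dimension of the state space -/
  t : ℕ
  d : (Fin m → K) →ₗ[K] (Fin n → K)
  c : (Fin t → K) →ₗ[K] (Fin n → K)
  a : (Fin s → K) →ₗ[K] (Fin t → K)
  b : (Fin m → K) →ₗ[K] (Fin s → K)

/-- Two squares are equivalent when they have the same `d` and there are isomorphisms of the
prestate spaces and of the state spaces that commute with the other sides. -/
def Square.Rel {m n : ℕ} (x y : Square K m n) : Prop :=
  ∃ (α : (Fin x.s → K) ≃ₗ[K] (Fin y.s → K)) (ω : (Fin x.t → K) ≃ₗ[K] (Fin y.t → K)),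
    (∀ u, y.d u = x.d u) ∧ (∀ v, y.c (ω v) = x.c v) ∧ (∀ v, y.a (α v) = ω (x.a v)) ∧
      (∀ u, y.b u = α (x.b u))

/-- Equivalence of squares. -/
def squareSetoid (K : Type u) [Field K] (m n : ℕ) : Setoid (Square K m n) where
  r := Square.Rel
  iseqv :=
    ⟨fun _ => ⟨.refl K _, .refl K _, fun _ => rfl, fun _ => rfl, fun _ => rfl, fun _ => rfl⟩,
     fun ⟨α, ω, hd, hc, ha, hb⟩ => ⟨α.symm, ω.symm, fun u => (hd u).symm,
        fun v => by rw [← hc, ω.apply_symm_apply],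
        fun v => by rw [ω.eq_symm_apply, ← ha, α.apply_symm_apply],
        fun u => by rw [hb, α.symm_apply_apply]⟩,
     fun ⟨α, ω, hd, hc, ha, hb⟩ ⟨α', ω', hd', hc', ha', hb'⟩ =>
      ⟨α.trans α', ω.trans ω', fun u => by rw [hd', hd],
        fun v => by rw [LinearEquiv.trans_apply, hc', hc],
        fun v => by rw [LinearEquiv.trans_apply, LinearEquiv.trans_apply, ha', ha],
        fun u => by rw [LinearEquiv.trans_apply, hb', hb]⟩⟩

/-- `x` followed by `x'`: the composite `(d', c', a', b') ∘ (d, c, a, b)` is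
`(d' d, [d' c, c'], [[a, 0], [a' b' c a, a']], [b; b' d])`. -/
def Square.comp {l m n : ℕ} (x : Square K l m) (x' : Square K m n) : Square K l n where
  s := x.s + x'.s
  t := x.t + x'.t
  d := x'.d ∘ₗ x.d
  c := x'.d ∘ₗ x.c ∘ₗ fstL K x.t x'.t + x'.c ∘ₗ sndL K x.t x'.t
  a := pairL (x.a ∘ₗ fstL K x.s x'.s)
    (x'.a ∘ₗ x'.b ∘ₗ x.c ∘ₗ x.a ∘ₗ fstL K x.s x'.s + x'.a ∘ₗ sndL K x.s x'.s)
  b := pairL x.b (x'.b ∘ₗ x.d)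

/-- The monoidal product `(d ⊕ d', c ⊕ c', a ⊕ a', b ⊕ b')`. -/
def Square.tensor {m n m' n' : ℕ} (x : Square K m n) (x' : Square K m' n') :
    Square K (m + m') (n + n') where
  s := x.s + x'.s
  t := x.t + x'.t
  d := sumL x.d x'.d
  c := sumL x.c x'.c
  a := sumL x.a x'.a
  b := sumL x.b x'.b

/-- The square `(d, !, 0, 0)` with zero-dimensional prestate and state space. -/
def Square.ofLinear {m n : ℕ} (d : (Fin m → K) →ₗ[K] (Fin n → K)) : Square K m n where
  s := 0
  t := 0
  d := d
  c := 0
  a := 0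
  b := 0

/-- Direct sum of isomorphisms. -/
def sumE {m n m' n' : ℕ} (α : (Fin m → K) ≃ₗ[K] (Fin n → K))
    (β : (Fin m' → K) ≃ₗ[K] (Fin n' → K)) : (Fin (m + m') → K) ≃ₗ[K] (Fin (n + n') → K) :=
  LinearEquiv.ofLinearMap (sumL α.toLinearMap β.toLinearMap) (sumL α.symm.toLinearMap β.symm.toLinearMap)
    (by refine LinearMap.ext fun x => vec_ext ?_ ?_ <;> simp [sumL])
    (by refine LinearMap.ext fun x => vec_ext ?_ ?_ <;> simp [sumL])

@[simp] theorem fstL_sumE {m n m' n' : ℕ} (α : (Fin m → K) ≃ₗ[K] (Fin n → K))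
    (β : (Fin m' → K) ≃ₗ[K] (Fin n' → K)) (x : Fin (m + m') → K) :
    fstL K n n' (sumE α β x) = α (fstL K m m' x) := by
  simp [sumE, sumL]

@[simp] theorem sndL_sumE {m n m' n' : ℕ} (α : (Fin m → K) ≃ₗ[K] (Fin n → K))
    (β : (Fin m' → K) ≃ₗ[K] (Fin n' → K)) (x : Fin (m + m') → K) :
    sndL K n n' (sumE α β x) = β (sndL K m m' x) := by
  simp [sumE, sumL]

/-- Exchange of two blocks, as an isomorphism. -/
def swapE (K : Type u) [Field K] (m n : ℕ) : (Fin (m + n) → K) ≃ₗ[K] (Fin (n + m) → K) :=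
  LinearEquiv.ofLinearMap (swapL K m n) (swapL K n m)
    (by refine LinearMap.ext fun x => vec_ext ?_ ?_ <;> simp [swapL])
    (by refine LinearMap.ext fun x => vec_ext ?_ ?_ <;> simp [swapL])

@[simp] theorem fstL_swapE {m n : ℕ} (x : Fin (m + n) → K) :
    fstL K n m (swapE K m n x) = sndL K m n x := by simp [swapE, swapL]

@[simp] theorem sndL_swapE {m n : ℕ} (x : Fin (m + n) → K) :
    sndL K n m (swapE K m n x) = fstL K m n x := by simp [swapE, swapL]

/-- Exchange of the two middle blocks, as a linear map. -/
def midL (K : Type u) [Field K] (p q r s : ℕ) :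
    (Fin ((p + q) + (r + s)) → K) →ₗ[K] (Fin ((p + r) + (q + s)) → K) :=
  pairL (sumL (fstL K p q) (fstL K r s)) (sumL (sndL K p q) (sndL K r s))

/-- Exchange of the two middle blocks, as an isomorphism. -/
def midE (K : Type u) [Field K] (p q r s : ℕ) :
    (Fin ((p + q) + (r + s)) → K) ≃ₗ[K] (Fin ((p + r) + (q + s)) → K) :=
  LinearEquiv.ofLinearMap (midL K p q r s) (midL K p r q s)
    (by refine LinearMap.ext fun x => vec_ext (vec_ext ?_ ?_) (vec_ext ?_ ?_) <;> simp [midL, sumL])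
    (by refine LinearMap.ext fun x => vec_ext (vec_ext ?_ ?_) (vec_ext ?_ ?_) <;> simp [midL, sumL])

@[simp] theorem fst_fstL_midE {p q r s : ℕ} (x : Fin ((p + q) + (r + s)) → K) :
    fstL K p r (fstL K (p + r) (q + s) (midE K p q r s x)) = fstL K p q (fstL K _ _ x) := by
  simp [midE, midL, sumL]

@[simp] theorem snd_fstL_midE {p q r s : ℕ} (x : Fin ((p + q) + (r + s)) → K) :
    sndL K p r (fstL K (p + r) (q + s) (midE K p q r s x)) = fstL K r s (sndL K _ _ x) := by
  simp [midE, midL, sumL]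

@[simp] theorem fst_sndL_midE {p q r s : ℕ} (x : Fin ((p + q) + (r + s)) → K) :
    fstL K q s (sndL K (p + r) (q + s) (midE K p q r s x)) = sndL K p q (fstL K _ _ x) := by
  simp [midE, midL, sumL]

@[simp] theorem snd_sndL_midE {p q r s : ℕ} (x : Fin ((p + q) + (r + s)) → K) :
    sndL K q s (sndL K (p + r) (q + s) (midE K p q r s x)) = sndL K r s (sndL K _ _ x) := by
  simp [midE, midL, sumL]

/-- Morphisms of the Box construction: equivalence classes of squares. -/
def BoxHom (K : Type u) [Field K] (m n : ℕ) : Type u := Quotient (squareSetoid K m n)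

/-- The class of a square. -/
def Square.mk' {m n : ℕ} (x : Square K m n) : BoxHom K m n := Quotient.mk (squareSetoid K m n) x

theorem Square.sound {m n : ℕ} {x y : Square K m n} (h : Square.Rel x y) : x.mk' = y.mk' :=
  Quotient.sound (s := squareSetoid K m n) h

theorem BoxHom.ind {m n : ℕ} {p : BoxHom K m n → Prop} (h : ∀ x : Square K m n, p x.mk')
    (f : BoxHom K m n) : p f :=
  Quotient.ind (s := squareSetoid K m n) h f

theorem Square.rel_mk {m n s t s' t' : ℕ} {d d' : (Fin m → K) →ₗ[K] (Fin n → K)}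
    {c : (Fin t → K) →ₗ[K] (Fin n → K)} {a : (Fin s → K) →ₗ[K] (Fin t → K)}
    {b : (Fin m → K) →ₗ[K] (Fin s → K)} {c' : (Fin t' → K) →ₗ[K] (Fin n → K)}
    {a' : (Fin s' → K) →ₗ[K] (Fin t' → K)} {b' : (Fin m → K) →ₗ[K] (Fin s' → K)}
    (α : (Fin s → K) ≃ₗ[K] (Fin s' → K)) (ω : (Fin t → K) ≃ₗ[K] (Fin t' → K))
    (hd : ∀ u, d' u = d u) (hc : ∀ v, c' (ω v) = c v) (ha : ∀ v, a' (α v) = ω (a v))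
    (hb : ∀ u, b' u = α (b u)) :
    Square.Rel (⟨s, t, d, c, a, b⟩ : Square K m n) ⟨s', t', d', c', a', b'⟩ :=
  ⟨α, ω, hd, hc, ha, hb⟩

theorem Square.comp_mk {l m n s t s' t' : ℕ} (d : (Fin l → K) →ₗ[K] (Fin m → K))
    (c : (Fin t → K) →ₗ[K] (Fin m → K)) (a : (Fin s → K) →ₗ[K] (Fin t → K))
    (b : (Fin l → K) →ₗ[K] (Fin s → K)) (d' : (Fin m → K) →ₗ[K] (Fin n → K))
    (c' : (Fin t' → K) →ₗ[K] (Fin n → K)) (a' : (Fin s' → K) →ₗ[K] (Fin t' → K))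
    (b' : (Fin m → K) →ₗ[K] (Fin s' → K)) :
    Square.comp ⟨s, t, d, c, a, b⟩ ⟨s', t', d', c', a', b'⟩
      = ⟨s + s', t + t', d' ∘ₗ d, d' ∘ₗ c ∘ₗ fstL K t t' + c' ∘ₗ sndL K t t',
        pairL (a ∘ₗ fstL K s s')
          (a' ∘ₗ b' ∘ₗ c ∘ₗ a ∘ₗ fstL K s s' + a' ∘ₗ sndL K s s'),
        pairL b (b' ∘ₗ d)⟩ := rfl

theorem Square.tensor_mk {m n m' n' s t s' t' : ℕ} (d : (Fin m → K) →ₗ[K] (Fin n → K))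
    (c : (Fin t → K) →ₗ[K] (Fin n → K)) (a : (Fin s → K) →ₗ[K] (Fin t → K))
    (b : (Fin m → K) →ₗ[K] (Fin s → K)) (d' : (Fin m' → K) →ₗ[K] (Fin n' → K))
    (c' : (Fin t' → K) →ₗ[K] (Fin n' → K)) (a' : (Fin s' → K) →ₗ[K] (Fin t' → K))
    (b' : (Fin m' → K) →ₗ[K] (Fin s' → K)) :
    Square.tensor ⟨s, t, d, c, a, b⟩ ⟨s', t', d', c', a', b'⟩
      = ⟨s + s', t + t', sumL d d', sumL c c', sumL a a', sumL b b'⟩ := rfl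

theorem Square.comp_rel {l m n : ℕ} {x y : Square K l m} {x' y' : Square K m n}
    (h : Square.Rel x y) (h' : Square.Rel x' y') : Square.Rel (x.comp x') (y.comp y') := by
  obtain ⟨α, ω, hd, hc, ha, hb⟩ := h
  obtain ⟨α', ω', hd', hc', ha', hb'⟩ := h'
  refine Square.rel_mk (sumE α α') (sumE ω ω') (fun u => ?_) (fun v => ?_) (fun v => ?_)
    (fun u => ?_)
  · simp [hd, hd']
  · simp [hc, hc', hd']
  · refine vec_ext ?_ ?_ <;> simp [ha, ha', hc, hb']
  · refine vec_ext ?_ ?_ <;> simp [hb, hb', hd]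

theorem Square.tensor_rel {m n m' n' : ℕ} {x y : Square K m n} {x' y' : Square K m' n'}
    (h : Square.Rel x y) (h' : Square.Rel x' y') : Square.Rel (x.tensor x') (y.tensor y') := by
  obtain ⟨α, ω, hd, hc, ha, hb⟩ := h
  obtain ⟨α', ω', hd', hc', ha', hb'⟩ := h'
  refine Square.rel_mk (sumE α α') (sumE ω ω') (fun u => ?_) (fun v => ?_) (fun v => ?_)
    (fun u => ?_) <;>
    refine vec_ext ?_ ?_ <;> simp [sumL, hd, hd', hc, hc', ha, ha', hb, hb']

/-- Composition in the Box construction. -/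
def BoxHom.comp {l m n : ℕ} (f : BoxHom K l m) (g : BoxHom K m n) : BoxHom K l n :=
  Quotient.lift₂ (s₁ := squareSetoid K l m) (s₂ := squareSetoid K m n)
    (fun x y => (x.comp y).mk') (fun _ _ _ _ h h' => Square.sound (Square.comp_rel h h')) f g

/-- Monoidal product in the Box construction. -/
def BoxHom.tensor {m n m' n' : ℕ} (f : BoxHom K m n) (g : BoxHom K m' n') :
    BoxHom K (m + m') (n + n') :=
  Quotient.lift₂ (s₁ := squareSetoid K m n) (s₂ := squareSetoid K m' n')
    (fun x y => (x.tensor y).mk') (fun _ _ _ _ h h' => Square.sound (Square.tensor_rel h h')) f g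

theorem BoxHom.comp_mk' {l m n : ℕ} (x : Square K l m) (y : Square K m n) :
    BoxHom.comp x.mk' y.mk' = (x.comp y).mk' := rfl

theorem BoxHom.tensor_mk' {m n m' n' : ℕ} (x : Square K m n) (y : Square K m' n') :
    BoxHom.tensor x.mk' y.mk' = (x.tensor y).mk' := rfl

theorem Square.castHom_eq {m n m' n' s t s' t' : ℕ} (hm : m = m') (hn : n = n')
    {d : (Fin m → K) →ₗ[K] (Fin n → K)} {c : (Fin t → K) →ₗ[K] (Fin n → K)}
    {a : (Fin s → K) →ₗ[K] (Fin t → K)} {b : (Fin m → K) →ₗ[K] (Fin s → K)}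
    {d' : (Fin m' → K) →ₗ[K] (Fin n' → K)} {c' : (Fin t' → K) →ₗ[K] (Fin n' → K)}
    {a' : (Fin s' → K) →ₗ[K] (Fin t' → K)} {b' : (Fin m' → K) →ₗ[K] (Fin s' → K)}
    (α : (Fin s → K) ≃ₗ[K] (Fin s' → K)) (ω : (Fin t → K) ≃ₗ[K] (Fin t' → K))
    (hd : ∀ u, d' (castL K hm u) = castL K hn (d u))
    (hc : ∀ v, c' (ω v) = castL K hn (c v))
    (ha : ∀ v, a' (α v) = ω (a v))
    (hb : ∀ u, b' (castL K hm u) = α (b u)) :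
    castHom (H := BoxHom K) hm hn (Square.mk' ⟨s, t, d, c, a, b⟩)
      = Square.mk' ⟨s', t', d', c', a', b'⟩ := by
  subst hm hn
  exact Square.sound ⟨α, ω, hd, hc, ha, hb⟩

theorem castHom_ofLinear {m n m' n' : ℕ} (hm : m = m') (hn : n = n')
    (f : (Fin m → K) →ₗ[K] (Fin n → K)) :
    castHom (H := BoxHom K) hm hn (Square.ofLinear f).mk'
      = (Square.ofLinear
          (castHom (H := fun m n => (Fin m → K) →ₗ[K] (Fin n → K)) hm hn f)).mk' := by
  subst hm hn; rfl

theorem ofLinear_comp {l m n : ℕ} (f : (Fin l → K) →ₗ[K] (Fin m → K))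
    (g : (Fin m → K) →ₗ[K] (Fin n → K)) :
    BoxHom.comp (Square.ofLinear f).mk' (Square.ofLinear g).mk'
      = (Square.ofLinear (g ∘ₗ f)).mk' := by
  simp only [BoxHom.comp_mk', BoxHom.tensor_mk', Square.ofLinear, Square.comp_mk, Square.tensor_mk]
  exact Square.sound (Square.rel_mk (.refl K _) (.refl K _) (fun _ => rfl) (fun v => by simp)
    (fun v => Subsingleton.elim (α := Fin 0 → K) _ _)
    (fun v => Subsingleton.elim (α := Fin 0 → K) _ _))

theorem ofLinear_tensor {m n m' n' : ℕ} (f : (Fin m → K) →ₗ[K] (Fin n → K))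
    (g : (Fin m' → K) →ₗ[K] (Fin n' → K)) :
    BoxHom.tensor (Square.ofLinear f).mk' (Square.ofLinear g).mk'
      = (Square.ofLinear (sumL f g)).mk' := by
  simp only [BoxHom.comp_mk', BoxHom.tensor_mk', Square.ofLinear, Square.comp_mk, Square.tensor_mk]
  exact Square.sound (Square.rel_mk (.refl K _) (.refl K _) (fun _ => rfl)
    (fun v => by refine vec_ext ?_ ?_ <;> simp [sumL])
    (fun v => Subsingleton.elim (α := Fin 0 → K) _ _)
    (fun v => Subsingleton.elim (α := Fin 0 → K) _ _))

/-- The PROP given by the Box construction on linear maps. -/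
def Box (K : Type u) [Field K] : PROP.{u} where
  Hom := BoxHom K
  id n := (Square.ofLinear (LinearMap.id : (Fin n → K) →ₗ[K] (Fin n → K))).mk'
  comp := BoxHom.comp
  tensor := BoxHom.tensor
  braid m n := (Square.ofLinear (swapL K m n)).mk'
  id_comp := fun f => by
    induction f using BoxHom.ind with | h x =>
    obtain ⟨s, t, d, c, a, b⟩ := x
    simp only [BoxHom.comp_mk', BoxHom.tensor_mk', Square.ofLinear, Square.comp_mk, Square.tensor_mk]
    refine Square.sound (Square.rel_mk (castL K (zero_add s)) (castL K (zero_add t))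
      (fun u => rfl) (fun v => ?_) (fun v => ?_) (fun u => ?_)) <;>
    simp [castL_zero_add]
  comp_id := fun f => by
    induction f using BoxHom.ind with | h x =>
    obtain ⟨s, t, d, c, a, b⟩ := x
    simp only [BoxHom.comp_mk', BoxHom.tensor_mk', Square.ofLinear, Square.comp_mk, Square.tensor_mk]
    refine Square.sound (Square.rel_mk (.refl K _) (.refl K _) (fun u => rfl) (fun v => ?_)
      (fun v => ?_) (fun u => ?_))
    · exact (add_zero _).symm
    · exact (fstL_pairL _ _ _).symm
    · exact (fstL_pairL _ _ _).symm
  assoc := fun f g h => by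
    induction f using BoxHom.ind with | h x =>
    induction g using BoxHom.ind with | h y =>
    induction h using BoxHom.ind with | h z =>
    obtain ⟨s₁, t₁, d₁, c₁, a₁, b₁⟩ := x
    obtain ⟨s₂, t₂, d₂, c₂, a₂, b₂⟩ := y
    obtain ⟨s₃, t₃, d₃, c₃, a₃, b₃⟩ := z
    simp only [BoxHom.comp_mk', BoxHom.tensor_mk', Square.ofLinear, Square.comp_mk, Square.tensor_mk]
    refine Square.sound (Square.rel_mk (castL K (add_assoc s₁ s₂ s₃)) (castL K (add_assoc t₁ t₂ t₃))
      (fun u => rfl) (fun v => ?_) (fun v => ?_) (fun u => ?_))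
    · simp [fstL_castL_assoc, fst_sndL_castL_assoc, snd_sndL_castL_assoc, add_assoc]
    · refine vec_ext ?_ (vec_ext ?_ ?_)
      · simp [fstL_castL_assoc]
      · simp [fstL_castL_assoc, fst_sndL_castL_assoc]
      · simp [fstL_castL_assoc, fst_sndL_castL_assoc, snd_sndL_castL_assoc]
        abel
    · refine vec_ext ?_ (vec_ext ?_ ?_) <;>
      simp [fstL_castL_assoc, fst_sndL_castL_assoc, snd_sndL_castL_assoc]
  tensor_id m n := (ofLinear_tensor _ _).trans
    (congrArg (fun f => (Square.ofLinear f).mk') ((FinVect K).tensor_id m n))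
  tensor_comp := fun f g f' g' => by
    induction f using BoxHom.ind with | h x =>
    induction g using BoxHom.ind with | h y =>
    induction f' using BoxHom.ind with | h x' =>
    induction g' using BoxHom.ind with | h y' =>
    obtain ⟨s₁, t₁, d₁, c₁, a₁, b₁⟩ := x
    obtain ⟨s₂, t₂, d₂, c₂, a₂, b₂⟩ := y
    obtain ⟨s₃, t₃, d₃, c₃, a₃, b₃⟩ := x'
    obtain ⟨s₄, t₄, d₄, c₄, a₄, b₄⟩ := y'
    simp only [BoxHom.comp_mk', BoxHom.tensor_mk', Square.ofLinear, Square.comp_mk, Square.tensor_mk]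
    refine Square.sound (Square.rel_mk (midE K s₁ s₂ s₃ s₄) (midE K t₁ t₂ t₃ t₄)
      (fun u => ?_) (fun v => ?_) (fun v => ?_) (fun u => ?_))
    · refine vec_ext ?_ ?_ <;> simp [sumL]
    · refine vec_ext ?_ ?_ <;> simp [sumL]
    · refine vec_ext (vec_ext ?_ ?_) (vec_ext ?_ ?_) <;> simp [sumL]
    · refine vec_ext (vec_ext ?_ ?_) (vec_ext ?_ ?_) <;> simp [sumL]
  tensor_assoc := fun f g h => by
    induction f using BoxHom.ind with | h x =>
    induction g using BoxHom.ind with | h y =>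
    induction h using BoxHom.ind with | h z =>
    obtain ⟨s₁, t₁, d₁, c₁, a₁, b₁⟩ := x
    obtain ⟨s₂, t₂, d₂, c₂, a₂, b₂⟩ := y
    obtain ⟨s₃, t₃, d₃, c₃, a₃, b₃⟩ := z
    simp only [BoxHom.comp_mk', BoxHom.tensor_mk', Square.ofLinear, Square.comp_mk, Square.tensor_mk]
    refine Square.castHom_eq _ _ (castL K (add_assoc s₁ s₂ s₃)) (castL K (add_assoc t₁ t₂ t₃))
      (fun u => ?_) (fun v => ?_) (fun v => ?_) (fun u => ?_) <;>
    refine vec_ext ?_ (vec_ext ?_ ?_) <;>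
    simp [sumL, fstL_castL_assoc, fst_sndL_castL_assoc, snd_sndL_castL_assoc]
  id_zero_tensor := fun f => by
    induction f using BoxHom.ind with | h x =>
    obtain ⟨s, t, d, c, a, b⟩ := x
    simp only [BoxHom.comp_mk', BoxHom.tensor_mk', Square.ofLinear, Square.comp_mk, Square.tensor_mk]
    refine Square.castHom_eq _ _ (castL K (zero_add s)) (castL K (zero_add t))
      (fun u => ?_) (fun v => ?_) (fun v => ?_) (fun u => ?_) <;>
    simp [castL_zero_add, sumL]
  tensor_id_zero := fun f => by
    induction f using BoxHom.ind with | h x =>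
    exact Square.castHom_eq _ _ (.refl K _) (.refl K _)
      (fun u => (fstL_pairL _ _ _).symm) (fun v => (fstL_pairL _ _ _).symm)
      (fun v => (fstL_pairL _ _ _).symm) (fun u => (fstL_pairL _ _ _).symm)
  braid_natural := fun f g => by
    induction f using BoxHom.ind with | h x =>
    induction g using BoxHom.ind with | h y =>
    obtain ⟨s₁, t₁, d₁, c₁, a₁, b₁⟩ := x
    obtain ⟨s₂, t₂, d₂, c₂, a₂, b₂⟩ := y
    simp only [BoxHom.comp_mk', BoxHom.tensor_mk', Square.ofLinear, Square.comp_mk, Square.tensor_mk]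
    refine Square.sound (Square.rel_mk
      ((swapE K s₁ s₂).trans (castL K (zero_add (s₂ + s₁)).symm))
      ((swapE K t₁ t₂).trans (castL K (zero_add (t₂ + t₁)).symm))
      (fun u => ?_) (fun v => ?_) (fun v => ?_) (fun u => ?_))
    · refine vec_ext ?_ ?_ <;> simp [sumL, swapL]
    · refine vec_ext ?_ ?_ <;> simp [sumL, swapL, sndL_zero_add, fstL_add_zero]
    · have h := pairL_zero ((pairL (a₁ ∘ₗ fstL K s₁ s₂) (a₂ ∘ₗ sndL K s₁ s₂)) ∘ₗ fstL K (s₁ + s₂) 0) 0 v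
      refine vec_ext (Subsingleton.elim (α := Fin 0 → K) _ _) (vec_ext ?_ ?_) <;>
      simp [sumL, sndL_zero_add]
      · exact ((congrArg (sndL K t₁ t₂) h).trans (sndL_pairL _ _ _)).symm
      · exact ((congrArg (fstL K t₁ t₂) h).trans (fstL_pairL _ _ _)).symm
    · have h := pairL_zero (pairL (b₁ ∘ₗ fstL K _ _) (b₂ ∘ₗ sndL K _ _)) 0 u
      refine vec_ext (Subsingleton.elim (α := Fin 0 → K) _ _) (vec_ext ?_ ?_) <;>
      simp [sumL, swapL, sndL_zero_add]
      · exact ((congrArg (sndL K s₁ s₂) h).trans (sndL_pairL _ _ _)).symm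
      · exact ((congrArg (fstL K s₁ s₂) h).trans (fstL_pairL _ _ _)).symm
  braid_braid m n := (ofLinear_comp _ _).trans
    (congrArg (fun f => (Square.ofLinear f).mk') ((FinVect K).braid_braid m n))
  hexagon m n p := by
    have h := congrArg (fun f => (Square.ofLinear f).mk') ((FinVect K).hexagon m n p)
    refine Eq.trans ?_ h
    refine Eq.trans (congrArg₂ BoxHom.comp ?_ ?_) (ofLinear_comp _ _)
    · exact Eq.trans (congrArg _ (ofLinear_tensor _ _)) (castHom_ofLinear _ _ _)
    · exact Eq.trans (congrArg _ (ofLinear_tensor _ _)) (castHom_ofLinear _ _ _)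

/-- Evaluation `(d, c, a, b) ↦ d + c a b`. -/
def boxEval (K : Type u) [Field K] : PROPHom (Box K) (FinVect K) where
  map f := Quotient.lift (s := squareSetoid K _ _) (fun x => x.d + x.c ∘ₗ x.a ∘ₗ x.b)
    (fun x y ⟨α, ω, hd, hc, ha, hb⟩ => LinearMap.ext fun u => by simp [hd, hb, ha, hc]) f
  map_id n := by
    refine LinearMap.ext fun u => ?_
    change u + _ = u
    simp [Square.ofLinear]
  map_comp f g := by
    induction f using BoxHom.ind with | h x =>
    induction g using BoxHom.ind with | h y =>
    obtain ⟨s₁, t₁, d₁, c₁, a₁, b₁⟩ := x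
    obtain ⟨s₂, t₂, d₂, c₂, a₂, b₂⟩ := y
    refine LinearMap.ext fun u => ?_
    change d₂ (d₁ u) + (d₂ ∘ₗ c₁ ∘ₗ fstL K t₁ t₂ + c₂ ∘ₗ sndL K t₁ t₂) (pairL (a₁ ∘ₗ fstL K s₁ s₂)
        (a₂ ∘ₗ b₂ ∘ₗ c₁ ∘ₗ a₁ ∘ₗ fstL K s₁ s₂ + a₂ ∘ₗ sndL K s₁ s₂) (pairL b₁ (b₂ ∘ₗ d₁) u))
      = d₂ (d₁ u + c₁ (a₁ (b₁ u))) + c₂ (a₂ (b₂ (d₁ u + c₁ (a₁ (b₁ u)))))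
    simp
    abel
  map_tensor f g := by
    induction f using BoxHom.ind with | h x =>
    induction g using BoxHom.ind with | h y =>
    refine LinearMap.ext fun u => ?_
    change sumL x.d y.d u + sumL x.c y.c (sumL x.a y.a (sumL x.b y.b u))
      = sumL (x.d + x.c ∘ₗ x.a ∘ₗ x.b) (y.d + y.c ∘ₗ y.a ∘ₗ y.b) u
    refine vec_ext ?_ ?_ <;> simp [sumL]
  map_braid m n := by
    refine LinearMap.ext fun u => ?_
    change swapL K m n u + _ = swapL K m n u
    simp [Square.ofLinear]

end Box

/-! ### Stateful morphisms -/

section Stateful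

variable {k : Type u} [Field k]

/-- Extension of scalars of a linear map from `k` to the field `k(s)` of rational functions. -/
def extend {m n : ℕ} (f : (Fin m → k) →ₗ[k] (Fin n → k)) :
    (Fin m → RatFunc k) →ₗ[RatFunc k] (Fin n → RatFunc k) :=
  Matrix.toLin' ((LinearMap.toMatrix' f).map (RatFunc.C : k →+* RatFunc k))

/-- The linear map `(s I - A)⁻¹` over `k(s)`, where `s` is the variable of `k(s)`. -/
def resolvent {n : ℕ} (A : (Fin n → k) →ₗ[k] (Fin n → k)) :
    (Fin n → RatFunc k) →ₗ[RatFunc k] (Fin n → RatFunc k) :=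
  Matrix.toLin' (((RatFunc.X : RatFunc k) • (1 : Matrix (Fin n) (Fin n) (RatFunc k))
    - (LinearMap.toMatrix' A).map (RatFunc.C : k →+* RatFunc k))⁻¹)

theorem isUnit_det_resolvent {n : ℕ} (A : (Fin n → k) →ₗ[k] (Fin n → k)) :
    IsUnit ((RatFunc.X : RatFunc k) • (1 : Matrix (Fin n) (Fin n) (RatFunc k))
      - (LinearMap.toMatrix' A).map (RatFunc.C : k →+* RatFunc k)).det := by
  have h : (RatFunc.X : RatFunc k) • (1 : Matrix (Fin n) (Fin n) (RatFunc k))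
      - (LinearMap.toMatrix' A).map (RatFunc.C : k →+* RatFunc k)
      = (Matrix.charmatrix (LinearMap.toMatrix' A)).map
          (algebraMap (Polynomial k) (RatFunc k)) := by
    ext i j
    by_cases hij : i = j
    · subst hij; simp [Matrix.charmatrix_apply_eq]
    · simp [Matrix.charmatrix_apply_ne _ _ _ hij, Matrix.one_apply_ne hij]
  rw [h, isUnit_iff_ne_zero, ← RingHom.mapMatrix_apply, ← RingHom.map_det]
  intro h0
  have := (map_eq_zero_iff _ (IsFractionRing.injective (Polynomial k) (RatFunc k))).1 h0
  exact (Matrix.charpoly_monic (LinearMap.toMatrix' A)).ne_zero this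

theorem toLin'_resolvent {n : ℕ} (A : (Fin n → k) →ₗ[k] (Fin n → k)) :
    Matrix.toLin' ((RatFunc.X : RatFunc k) • (1 : Matrix (Fin n) (Fin n) (RatFunc k))
      - (LinearMap.toMatrix' A).map (RatFunc.C : k →+* RatFunc k))
      = (RatFunc.X : RatFunc k) • LinearMap.id - extend A := by
  simp [extend]

theorem resolvent_apply {n : ℕ} (A : (Fin n → k) →ₗ[k] (Fin n → k)) (x : Fin n → RatFunc k) :
    (RatFunc.X : RatFunc k) • resolvent A x - extend A (resolvent A x) = x := by
  have h := congrArg Matrix.toLin' (Matrix.mul_nonsing_inv _ (isUnit_det_resolvent A))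
  rw [Matrix.toLin'_mul, toLin'_resolvent, Matrix.toLin'_one] at h
  exact LinearMap.congr_fun h x

theorem resolvent_unique {n : ℕ} (A : (Fin n → k) →ₗ[k] (Fin n → k)) {x y : Fin n → RatFunc k}
    (h : (RatFunc.X : RatFunc k) • y - extend A y = x) : y = resolvent A x := by
  have h' := congrArg Matrix.toLin' (Matrix.nonsing_inv_mul _ (isUnit_det_resolvent A))
  rw [Matrix.toLin'_mul, toLin'_resolvent, Matrix.toLin'_one] at h'
  have := LinearMap.congr_fun h' y
  rw [LinearMap.comp_apply] at this
  subst h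
  exact this.symm

theorem extend_const {m n : ℕ} (f : (Fin m → k) →ₗ[k] (Fin n → k)) (v : Fin m → k) :
    extend f (fun i => RatFunc.C (v i)) = fun j => RatFunc.C (f v j) := by
  ext j
  conv_rhs => rw [← LinearMap.toMatrix'_mulVec f v]
  simp [extend, Matrix.mulVec, dotProduct]

theorem ext_const {m n : ℕ} {f g : (Fin m → RatFunc k) →ₗ[RatFunc k] (Fin n → RatFunc k)}
    (h : ∀ v : Fin m → k, f (fun i => RatFunc.C (v i)) = g (fun i => RatFunc.C (v i))) :
    f = g := by
  refine LinearMap.pi_ext' fun i => LinearMap.ext_ring ?_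
  have := h (Pi.single i 1)
  have e : (fun j => RatFunc.C ((Pi.single i 1 : Fin m → k) j)) = (Pi.single i 1 : _ → RatFunc k) := by
    ext j
    by_cases hj : j = i
    · subst hj; simp
    · simp [Pi.single_eq_of_ne hj]
  rw [e] at this
  exact this

theorem extend_id (n : ℕ) : extend (LinearMap.id : (Fin n → k) →ₗ[k] (Fin n → k)) = LinearMap.id :=
  ext_const fun v => by rw [extend_const]; rfl

theorem extend_comp {l m n : ℕ} (f : (Fin l → k) →ₗ[k] (Fin m → k))
    (g : (Fin m → k) →ₗ[k] (Fin n → k)) : extend (g ∘ₗ f) = extend g ∘ₗ extend f :=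
  ext_const fun v => by
    rw [extend_const, LinearMap.comp_apply, LinearMap.comp_apply, extend_const, extend_const]

theorem extend_add {m n : ℕ} (f g : (Fin m → k) →ₗ[k] (Fin n → k)) :
    extend (f + g) = extend f + extend g :=
  ext_const fun v => by
    rw [extend_const, LinearMap.add_apply, LinearMap.add_apply, extend_const, extend_const]
    ext j
    simp

theorem extend_zero (m n : ℕ) : extend (0 : (Fin m → k) →ₗ[k] (Fin n → k)) = 0 :=
  ext_const fun v => by
    rw [extend_const]
    ext j
    simp

theorem extend_fstL (m n : ℕ) : extend (fstL k m n) = fstL (RatFunc k) m n :=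
  ext_const fun v => by rw [extend_const]; rfl

theorem extend_sndL (m n : ℕ) : extend (sndL k m n) = sndL (RatFunc k) m n :=
  ext_const fun v => by rw [extend_const]; rfl

theorem extend_pairL {l m n : ℕ} (f : (Fin l → k) →ₗ[k] (Fin m → k))
    (g : (Fin l → k) →ₗ[k] (Fin n → k)) : extend (pairL f g) = pairL (extend f) (extend g) := by
  refine LinearMap.ext fun x => vec_ext ?_ ?_
  · rw [fstL_pairL, ← extend_fstL, ← LinearMap.comp_apply, ← extend_comp]
    congr 1
    exact congrArg extend (LinearMap.ext fun x => fstL_pairL f g x)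
  · rw [sndL_pairL, ← extend_sndL, ← LinearMap.comp_apply, ← extend_comp]
    congr 1
    exact congrArg extend (LinearMap.ext fun x => sndL_pairL f g x)

theorem extend_sumL {m n m' n' : ℕ} (f : (Fin m → k) →ₗ[k] (Fin n → k))
    (g : (Fin m' → k) →ₗ[k] (Fin n' → k)) : extend (sumL f g) = sumL (extend f) (extend g) := by
  rw [sumL, extend_pairL, extend_comp, extend_comp, extend_fstL, extend_sndL]; rfl

theorem extend_swapL (m n : ℕ) : extend (swapL k m n) = swapL (RatFunc k) m n := by
  rw [swapL, extend_pairL, extend_fstL, extend_sndL]; rfl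

/-- The class of the square `(D, C, (s I - A)⁻¹, B)`. -/
def statefulHom {m n p : ℕ} (D : (Fin m → k) →ₗ[k] (Fin p → k)) (C : (Fin n → k) →ₗ[k] (Fin p → k))
    (A : (Fin n → k) →ₗ[k] (Fin n → k)) (B : (Fin m → k) →ₗ[k] (Fin n → k)) :
    (Box (RatFunc k)).Hom m p :=
  Square.mk' ⟨n, n, extend D, extend C, resolvent A, extend B⟩

/-- The stateful morphisms: those of the form `(D, C, (s I - A)⁻¹, B)` with `A`, `B`, `C`, `D`
linear maps over `k`. -/
def statefulSet (k : Type u) [Field k] (m p : ℕ) : Set ((Box (RatFunc k)).Hom m p) :=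
  {f | ∃ (n : ℕ) (A : (Fin n → k) →ₗ[k] (Fin n → k)) (B : (Fin m → k) →ₗ[k] (Fin n → k))
    (C : (Fin n → k) →ₗ[k] (Fin p → k)) (D : (Fin m → k) →ₗ[k] (Fin p → k)),
    f = statefulHom D C A B}

theorem statefulHom_ofLinear {m p : ℕ} (D : (Fin m → k) →ₗ[k] (Fin p → k)) :
    statefulHom D (0 : (Fin 0 → k) →ₗ[k] (Fin p → k)) 0 0 = (Square.ofLinear (extend D)).mk' :=
  Square.sound (Square.rel_mk (.refl _ _) (.refl _ _) (fun _ => rfl)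
    (fun v => by rw [extend_zero]; rfl)
    (fun v => Subsingleton.elim (α := Fin 0 → RatFunc k) _ _)
    (fun v => Subsingleton.elim (α := Fin 0 → RatFunc k) _ _))

theorem resolvent_comp {n n' : ℕ} (A : (Fin n → k) →ₗ[k] (Fin n → k))
    (A' : (Fin n' → k) →ₗ[k] (Fin n' → k)) (E : (Fin n → k) →ₗ[k] (Fin n' → k))
    (x : Fin (n + n') → RatFunc k) :
    pairL (resolvent A ∘ₗ fstL (RatFunc k) n n')
      (resolvent A' ∘ₗ extend E ∘ₗ resolvent A ∘ₗ fstL (RatFunc k) n n'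
        + resolvent A' ∘ₗ sndL (RatFunc k) n n') x
      = resolvent (pairL (A ∘ₗ fstL k n n') (E ∘ₗ fstL k n n' + A' ∘ₗ sndL k n n')) x := by
  refine resolvent_unique _ ?_
  rw [extend_pairL, extend_add, extend_comp, extend_comp, extend_comp, extend_fstL, extend_sndL]
  refine vec_ext ?_ ?_
  · simp only [map_sub, map_smul, fstL_pairL, LinearMap.comp_apply]
    exact resolvent_apply _ _
  · simp only [map_sub, map_smul, sndL_pairL, fstL_pairL, LinearMap.comp_apply,
      LinearMap.add_apply]
    have h := resolvent_apply A' (extend E (resolvent A (fstL (RatFunc k) n n' x)))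
    have h' := resolvent_apply A' (sndL (RatFunc k) n n' x)
    rw [smul_add, map_add]
    rw [sub_eq_iff_eq_add.1 h, sub_eq_iff_eq_add.1 h']
    abel

theorem statefulHom_comp {l m p n n' : ℕ} (D : (Fin l → k) →ₗ[k] (Fin m → k))
    (C : (Fin n → k) →ₗ[k] (Fin m → k)) (A : (Fin n → k) →ₗ[k] (Fin n → k))
    (B : (Fin l → k) →ₗ[k] (Fin n → k)) (D' : (Fin m → k) →ₗ[k] (Fin p → k))
    (C' : (Fin n' → k) →ₗ[k] (Fin p → k)) (A' : (Fin n' → k) →ₗ[k] (Fin n' → k))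
    (B' : (Fin m → k) →ₗ[k] (Fin n' → k)) :
    (Box (RatFunc k)).comp (statefulHom D C A B) (statefulHom D' C' A' B')
      = statefulHom (D' ∘ₗ D) (D' ∘ₗ C ∘ₗ fstL k n n' + C' ∘ₗ sndL k n n')
          (pairL (A ∘ₗ fstL k n n') ((B' ∘ₗ C) ∘ₗ fstL k n n' + A' ∘ₗ sndL k n n'))
          (pairL B (B' ∘ₗ D)) := by
  refine Square.sound (Square.rel_mk (.refl _ _) (.refl _ _) (fun v => ?_) (fun v => ?_)
    (fun v => ?_) (fun v => ?_))
  · rw [extend_comp]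
  · rw [extend_add, extend_comp, extend_comp, extend_comp, extend_fstL, extend_sndL]; rfl
  · rw [LinearEquiv.refl_apply, LinearEquiv.refl_apply, ← resolvent_comp, extend_comp]; rfl
  · rw [extend_pairL, extend_comp]; rfl

theorem resolvent_sum {n n' : ℕ} (A : (Fin n → k) →ₗ[k] (Fin n → k))
    (A' : (Fin n' → k) →ₗ[k] (Fin n' → k)) (x : Fin (n + n') → RatFunc k) :
    sumL (resolvent A) (resolvent A') x = resolvent (sumL A A') x := by
  refine resolvent_unique _ ?_
  rw [extend_sumL]
  refine vec_ext ?_ ?_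
  · simp only [map_sub, map_smul, sumL, fstL_pairL, LinearMap.comp_apply]
    exact resolvent_apply _ _
  · simp only [map_sub, map_smul, sumL, sndL_pairL, LinearMap.comp_apply]
    exact resolvent_apply _ _

theorem statefulHom_tensor {m p n m' p' n' : ℕ} (D : (Fin m → k) →ₗ[k] (Fin p → k))
    (C : (Fin n → k) →ₗ[k] (Fin p → k)) (A : (Fin n → k) →ₗ[k] (Fin n → k))
    (B : (Fin m → k) →ₗ[k] (Fin n → k)) (D' : (Fin m' → k) →ₗ[k] (Fin p' → k))
    (C' : (Fin n' → k) →ₗ[k] (Fin p' → k)) (A' : (Fin n' → k) →ₗ[k] (Fin n' → k))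
    (B' : (Fin m' → k) →ₗ[k] (Fin n' → k)) :
    (Box (RatFunc k)).tensor (statefulHom D C A B) (statefulHom D' C' A' B')
      = statefulHom (sumL D D') (sumL C C') (sumL A A') (sumL B B') := by
  refine Square.sound (Square.rel_mk (.refl _ _) (.refl _ _) (fun v => ?_) (fun v => ?_)
    (fun v => ?_) (fun v => ?_))
  · rw [extend_sumL]
  · rw [extend_sumL]; rfl
  · rw [LinearEquiv.refl_apply, LinearEquiv.refl_apply, ← resolvent_sum]
  · rw [extend_sumL]; rfl

theorem statefulSet_isClosed (k : Type u) [Field k] :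
    (Box (RatFunc k)).IsClosed (statefulSet k) where
  id_mem n := ⟨0, 0, 0, 0, LinearMap.id, by rw [statefulHom_ofLinear, extend_id]; rfl⟩
  comp_mem := by
    rintro l m p _ _ ⟨n, A, B, C, D, rfl⟩ ⟨n', A', B', C', D', rfl⟩
    exact ⟨_, _, _, _, _, statefulHom_comp D C A B D' C' A' B'⟩
  tensor_mem := by
    rintro m p m' p' _ _ ⟨n, A, B, C, D, rfl⟩ ⟨n', A', B', C', D', rfl⟩
    exact ⟨_, _, _, _, _, statefulHom_tensor D C A B D' C' A' B'⟩
  braid_mem m n := ⟨0, 0, 0, 0, swapL k m n, by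
    rw [statefulHom_ofLinear, extend_swapL]; rfl⟩

/-- The PROP of stateful morphisms over `k`, a subPROP of the Box construction over `k(s)`. -/
def Stateful (k : Type u) [Field k] : PROP.{u} :=
  (Box (RatFunc k)).sub (statefulSet k) (statefulSet_isClosed k)

/-- Evaluation of stateful morphisms, `(D, C, (s I - A)⁻¹, B) ↦ D + C (s I - A)⁻¹ B`. -/
def statefulEval (k : Type u) [Field k] : PROPHom (Stateful k) (FinVect (RatFunc k)) :=
  ((Box (RatFunc k)).incl (statefulSet k) (statefulSet_isClosed k)).trans (boxEval (RatFunc k))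

end Stateful

/-! ### Signal-flow diagrams -/

/-- The generators `+, 0, Δ, !, ∪, ∩, s_c` (`c ∈ S`) of signal-flow diagrams. -/
inductive Gen (S : Type u) : ℕ → ℕ → Type u
  | add : Gen S 2 1
  | zero : Gen S 0 1
  | dup : Gen S 1 2
  | del : Gen S 1 0
  | cup : Gen S 2 0
  | cap : Gen S 0 2
  | scale (c : S) : Gen S 1 1

/-- The generators together with one extra generator, the integrator. -/
inductive GenInt (S : Type u) : ℕ → ℕ → Type u
  | base {m n : ℕ} (g : Gen S m n) : GenInt S m n
  | int : GenInt S 1 1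

section SignalFlowDiagrams

/-- Signal-flow diagrams over `k` without integrators. -/
def SigFlow (k : Type u) : PROP.{u} := Free (Gen k)

/-- Signal-flow diagrams over `k`, possibly with integrators. -/
def SigFlowInt (k : Type u) : PROP.{u} := Free (GenInt k)

/-- Change of scalars in generators. -/
def Gen.map {S T : Type u} (φ : S → T) : ∀ {m n : ℕ}, Gen S m n → Gen T m n
  | _, _, .add => .add
  | _, _, .zero => .zero
  | _, _, .dup => .dup
  | _, _, .del => .del
  | _, _, .cup => .cup
  | _, _, .cap => .cap
  | _, _, .scale c => .scale (φ c)

/-- The linear relations that the generators stand for: addition `(x, y) ↦ x + y`, the zero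
vector, duplication `x ↦ (x, x)`, deletion, the relation without output that requires the two inputs to be equal,
its converse, and scaling `x ↦ c x`. -/
def Gen.rel {K : Type u} [Field K] : ∀ {m n : ℕ}, Gen K m n → (FinRel K).Hom m n
  | _, _, .add =>
    LinearMap.graph (LinearMap.pi fun _ => ((LinearMap.proj 0 : (Fin 2 → K) →ₗ[K] K) + LinearMap.proj 1) :
      (Fin 2 → K) →ₗ[K] (Fin 1 → K))
  | _, _, .zero => LinearMap.graph (0 : (Fin 0 → K) →ₗ[K] (Fin 1 → K))
  | _, _, .dup =>
    LinearMap.graph (LinearMap.pi fun _ => (LinearMap.proj 0 : (Fin 1 → K) →ₗ[K] K) :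
      (Fin 1 → K) →ₗ[K] (Fin 2 → K))
  | _, _, .del => LinearMap.graph (0 : (Fin 1 → K) →ₗ[K] (Fin 0 → K))
  | _, _, .cup =>
    { carrier := {w | w.1 0 = w.1 1}
      zero_mem' := rfl
      add_mem' := fun h h' => congrArg₂ (· + ·) h h'
      smul_mem' := fun c _ h => congrArg (c * ·) h }
  | _, _, .cap =>
    { carrier := {w | w.2 0 = w.2 1}
      zero_mem' := rfl
      add_mem' := fun h h' => congrArg₂ (· + ·) h h'
      smul_mem' := fun c _ h => congrArg (c * ·) h }
  | _, _, .scale c => LinearMap.graph (c • LinearMap.id : (Fin 1 → K) →ₗ[K] (Fin 1 → K))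

/-- Black-boxing of signal-flow diagrams without integrators. -/
def blackBoxConst (K : Type u) [Field K] : PROPHom (SigFlow K) (FinRel K) :=
  Free.lift (FinRel K) (fun g => g.rel)

/-- The linear relations over `k(s)` that the generators stand for; the integrator stands for
scaling by `1 / s`. -/
def GenInt.rel {k : Type u} [Field k] : ∀ {m n : ℕ}, GenInt k m n → (FinRel (RatFunc k)).Hom m n
  | _, _, .base g => (g.map (fun c => (RatFunc.C c : RatFunc k))).rel
  | _, _, .int => (Gen.scale ((RatFunc.X : RatFunc k)⁻¹)).rel

/-- Black-boxing of signal-flow diagrams with integrators. -/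
def blackBox (k : Type u) [Field k] : PROPHom (SigFlowInt k) (FinRel (RatFunc k)) :=
  Free.lift (FinRel (RatFunc k)) (fun g => g.rel)

/-! ### Cutting a diagram at its integrators -/

/-- Exchange of the last two blocks of wires. -/
def PROP.swapLast (P : PROP.{u}) (l m n : ℕ) : P.Hom (l + m + n) (l + n + m) :=
  castHom (add_assoc l m n).symm (add_assoc l n m).symm (P.tensor (P.id l) (P.braid m n))

/-- Exchange of the two middle blocks of wires. -/
def PROP.swapMid (P : PROP.{u}) (l m n p : ℕ) : P.Hom ((l + m) + (n + p)) ((l + n) + (m + p)) :=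
  castHom (by omega) (by omega) (P.tensor (P.tensor (P.id l) (P.braid m n)) (P.id p))

/-- The number of integrators in a generator. -/
def GenInt.ints {S : Type u} : ∀ {m n : ℕ}, GenInt S m n → ℕ
  | _, _, .base _ => 0
  | _, _, .int => 1

/-- The number of integrators in a diagram. -/
def Term.ints {S : Type u} : ∀ {m n : ℕ}, Term (GenInt S) m n → ℕ
  | _, _, .id _ => 0
  | _, _, .braid _ _ => 0
  | _, _, .gen g => g.ints
  | _, _, .comp f g => f.ints + g.ints
  | _, _, .tensor f g => f.ints + g.ints

/-- A generator, with the integrator removed: the integrator becomes two crossing wires, because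
its incoming wire is turned into an additional (last) output and its outgoing wire into an
additional (last) input. -/
def GenInt.cut {k : Type u} : ∀ {m n : ℕ} (g : GenInt k m n),
    (SigFlow k).Hom (m + g.ints) (n + g.ints)
  | _, _, .base g => (SigFlow k).tensor (Term.gen g).mk ((SigFlow k).id 0)
  | _, _, .int => (SigFlow k).braid 1 1

/-- A diagram `m → p` with all its `n` integrators removed: the `n` wires that left the integrators
become additional inputs, placed after the `m` old ones, and the `n` wires that entered the
integrators become additional outputs, placed after the `p` old ones. -/
def Term.cut {k : Type u} : ∀ {m p : ℕ} (t : Term (GenInt k) m p),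
    (SigFlow k).Hom (m + t.ints) (p + t.ints)
  | _, _, .id n => (SigFlow k).tensor ((SigFlow k).id n) ((SigFlow k).id 0)
  | _, _, .braid m n => (SigFlow k).tensor ((SigFlow k).braid m n) ((SigFlow k).id 0)
  | _, _, .gen g => g.cut
  | l, p, .comp (m := m) f g =>
    castHom (add_assoc l f.ints g.ints) (add_assoc p f.ints g.ints)
      ((SigFlow k).comp
        ((SigFlow k).comp ((SigFlow k).tensor f.cut ((SigFlow k).id g.ints))
          ((SigFlow k).swapLast m f.ints g.ints))
        ((SigFlow k).comp ((SigFlow k).tensor g.cut ((SigFlow k).id f.ints))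
          ((SigFlow k).swapLast p g.ints f.ints)))
  | _, _, .tensor (m := m) (n := n) (m' := m') (n' := n') f g =>
    (SigFlow k).comp
      ((SigFlow k).comp ((SigFlow k).swapMid m m' f.ints g.ints)
        ((SigFlow k).tensor f.cut g.cut))
      ((SigFlow k).swapMid n f.ints n' g.ints)

/-- `0 ^ n : 0 → n`. -/
def zeroAll (k : Type u) : ∀ n : ℕ, (SigFlow k).Hom 0 n
  | 0 => (SigFlow k).id 0
  | n + 1 => castHom (zero_add 0) rfl ((SigFlow k).tensor (zeroAll k n) (Term.gen Gen.zero).mk)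

/-- `! ^ n : n → 0`. -/
def delAll (k : Type u) : ∀ n : ℕ, (SigFlow k).Hom n 0
  | 0 => (SigFlow k).id 0
  | n + 1 => castHom rfl (zero_add 0) ((SigFlow k).tensor (delAll k n) (Term.gen Gen.del).mk)

variable {k : Type u} [Field k]

/-- The linear relation `A(f) : k ^ n ⇸ k ^ n` : in `! ^ p ∘ f ∘ 0 ^ m`, the wires leaving the
integrators become inputs and the wires entering them become outputs. -/
def relA {m p : ℕ} (t : Term (GenInt k) m p) : (FinRel k).Hom t.ints t.ints :=
  (blackBoxConst k).map <| castHom (zero_add _) (zero_add _) <|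
    (SigFlow k).comp
      ((SigFlow k).comp ((SigFlow k).tensor (zeroAll k m) ((SigFlow k).id t.ints)) t.cut)
      ((SigFlow k).tensor (delAll k p) ((SigFlow k).id t.ints))

/-- The linear relation `B(f) : k ^ m ⇸ k ^ n` : in `! ^ p ∘ f`, the wires entering the integrators
become outputs and the wires leaving them are replaced by `0 ^ n`. -/
def relB {m p : ℕ} (t : Term (GenInt k) m p) : (FinRel k).Hom m t.ints :=
  (blackBoxConst k).map <| castHom (add_zero _) (zero_add _) <|
    (SigFlow k).comp
      ((SigFlow k).comp ((SigFlow k).tensor ((SigFlow k).id m) (zeroAll k t.ints)) t.cut)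
      ((SigFlow k).tensor (delAll k p) ((SigFlow k).id t.ints))

/-- The linear relation `C(f) : k ^ n ⇸ k ^ p` : in `f ∘ 0 ^ m`, the wires leaving the integrators
become inputs and the wires entering them are replaced by `! ^ n`. -/
def relC {m p : ℕ} (t : Term (GenInt k) m p) : (FinRel k).Hom t.ints p :=
  (blackBoxConst k).map <| castHom (zero_add _) (add_zero _) <|
    (SigFlow k).comp
      ((SigFlow k).comp ((SigFlow k).tensor (zeroAll k m) ((SigFlow k).id t.ints)) t.cut)
      ((SigFlow k).tensor ((SigFlow k).id p) (delAll k t.ints))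

/-- The integrator is replaced by scaling by zero. -/
def GenInt.scaleZero : ∀ {m n : ℕ}, GenInt k m n → (SigFlow k).Hom m n
  | _, _, .base g => (Term.gen g).mk
  | _, _, .int => (Term.gen (Gen.scale (0 : k))).mk

/-- The linear relation `D(f) : k ^ m ⇸ k ^ p` : every integrator is replaced by scaling by zero. -/
def relD {m p : ℕ} (f : (SigFlowInt k).Hom m p) : (FinRel k).Hom m p :=
  (blackBoxConst k).map ((Free.lift (SigFlow k) (fun g => g.scaleZero)).map f)

/-- A linear relation is a linear map when it is the graph of one. -/
def RelIsMap {m n : ℕ} (R : (FinRel k).Hom m n) : Prop :=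
  ∃ f : (FinVect k).Hom m n, R = (graphHom k).map f

/-- The diagrams `f` for which `A(f)`, `B(f)`, `C(f)` and `D(f)` are linear maps.  The relations
`A(f)`, `B(f)` and `C(f)` depend on an enumeration of the integrators of `f`, which is the one
coming from a term that denotes `f`. -/
def contFlowSet (k : Type u) [Field k] (m p : ℕ) : Set ((SigFlowInt k).Hom m p) :=
  {f | ∃ t : Term (GenInt k) m p, t.mk = f ∧ RelIsMap (relA t) ∧ RelIsMap (relB t) ∧
    RelIsMap (relC t) ∧ RelIsMap (relD f)}

end SignalFlowDiagrams

end

end SignalFlow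

/-! The argument replaces a diagram by the behaviour it has once its integrators are removed. This
is a linear subspace over `k` of tuples `((u, x), (y, z))`: `u` and `y` are the outer inputs and
outputs, `x` lists the signals leaving the integrators and `z` those entering them. `Term.stateRel`
computes this subspace by recursion on terms. `Term.holds_cut` and `Term.holds_scaleZero` identify
it with the syntactic constructions: the extracted relations are slices of it, with `x = 0` or `u =
0` and with `y` or `z` forgotten.

Linearity is the decisive point. The four slices are graphs of `A`, `B`, `C`, `D` exactly when the
whole subspace is the solution set of `y = D u + C x`, `z = B u + A x` (`StateRel.realizes_iff`).
Behaviours of this form compose and add by the block matrices of the PROP of stateful morphisms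
(`Realizes.seq`, `Realizes.sum`). This gives both closure and functoriality.

The laws of a PROP reorder integrators, so terms denoting the same diagram have behaviours that
agree only up to an isomorphism of the state space (`Term.Rel.stateRel_equiv`). One isomorphism acts
on `x` and on `z` simultaneously. It therefore conjugates `A`, and hence `(s I - A)⁻¹`, so the class
of the square does not change (`Realizes.of_equiv`).

For the black box, scalars are extended to `k(s)` and each integrator is closed by `z = s x`.
Membership after extension is tested by all `k`-linear functionals on `k(s)`, and linear selections
show that this is compatible with composition (`exists_extension_of_forall`, `StateRel.ext_seq`).
Hence `Term.mem_blackBox` holds for every diagram. If the behaviour is given by `A`, `B`, `C`, `D`,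
the equation `s x = B u + A x` has the unique solution `x = (s I - A)⁻¹ B u`, and substituting it in
`y = D u + C x` gives the formula. -/

namespace SignalFlow

noncomputable section

variable {k : Type u} [Field k]

/-! ### Linear relations with a state -/

/-- Linear relations between inputs `u`, outputs `x` of integrators, outputs `y` and inputs `z` of
integrators, where the number of integrators is `n`; the vector is `((u, x), (y, z))`. -/
abbrev StateRel (k : Type u) [Field k] (n m p : ℕ) : Type u :=
  Submodule k (((Fin m → k) × (Fin n → k)) × ((Fin p → k) × (Fin n → k)))

namespace StateRel

/-- A linear relation, regarded as one without state. -/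
def ofRel {m p : ℕ} (R : Submodule k ((Fin m → k) × (Fin p → k))) : StateRel k 0 m p where
  carrier := {w | (w.1.1, w.2.1) ∈ R}
  zero_mem' := R.zero_mem
  add_mem' := fun h h' => R.add_mem h h'
  smul_mem' := fun c _ h => R.smul_mem c h

/-- The relation of a single integrator. -/
def int : StateRel k 1 1 1 where
  carrier := {w | w.2.1 = w.1.2 ∧ w.2.2 = w.1.1}
  zero_mem' := ⟨rfl, rfl⟩
  add_mem' := fun h h' => ⟨congrArg₂ (· + ·) h.1 h'.1, congrArg₂ (· + ·) h.2 h'.2⟩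
  smul_mem' := fun c _ h => ⟨congrArg (c • ·) h.1, congrArg (c • ·) h.2⟩

/-- Sequential composition; the states are collected in order. -/
def seq {l m p n n' : ℕ} (F : StateRel k n l m) (G : StateRel k n' m p) :
    StateRel k (n + n') l p where
  carrier := {w | ∃ v, ((w.1.1, fstL k n n' w.1.2), (v, fstL k n n' w.2.2)) ∈ F ∧
    ((v, sndL k n n' w.1.2), (w.2.1, sndL k n n' w.2.2)) ∈ G}
  zero_mem' := by
    refine ⟨0, ?_, ?_⟩ <;> simp only [Prod.fst_zero, Prod.snd_zero, map_zero]
    · exact F.zero_mem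
    · exact G.zero_mem
  add_mem' := by
    rintro w w' ⟨v, h₁, h₂⟩ ⟨v', h₁', h₂'⟩
    exact ⟨v + v', by simpa using F.add_mem h₁ h₁', by simpa using G.add_mem h₂ h₂'⟩
  smul_mem' := by
    rintro c w ⟨v, h₁, h₂⟩
    exact ⟨c • v, by simpa using F.smul_mem c h₁, by simpa using G.smul_mem c h₂⟩

/-- Direct sum; the states are collected in order. -/
def sum {m p m' p' n n' : ℕ} (F : StateRel k n m p) (G : StateRel k n' m' p') :
    StateRel k (n + n') (m + m') (p + p') where
  carrier := {w | ((fstL k m m' w.1.1, fstL k n n' w.1.2),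
      (fstL k p p' w.2.1, fstL k n n' w.2.2)) ∈ F ∧
    ((sndL k m m' w.1.1, sndL k n n' w.1.2), (sndL k p p' w.2.1, sndL k n n' w.2.2)) ∈ G}
  zero_mem' := by
    constructor <;> simp only [Prod.fst_zero, Prod.snd_zero, map_zero]
    · exact F.zero_mem
    · exact G.zero_mem
  add_mem' := by
    rintro w w' ⟨h₁, h₂⟩ ⟨h₁', h₂'⟩
    exact ⟨by simpa using F.add_mem h₁ h₁', by simpa using G.add_mem h₂ h₂'⟩
  smul_mem' := by
    rintro c w ⟨h₁, h₂⟩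
    exact ⟨by simpa using F.smul_mem c h₁, by simpa using G.smul_mem c h₂⟩

theorem mem_ofRel {m p : ℕ} {R : Submodule k ((Fin m → k) × (Fin p → k))} {u : Fin m → k}
    {x : Fin 0 → k} {y : Fin p → k} {z : Fin 0 → k} :
    ((u, x), (y, z)) ∈ ofRel R ↔ (u, y) ∈ R := Iff.rfl

theorem mem_seq {l m p n n' : ℕ} {F : StateRel k n l m} {G : StateRel k n' m p}
    {u : Fin l → k} {x : Fin (n + n') → k} {y : Fin p → k} {z : Fin (n + n') → k} :
    ((u, x), (y, z)) ∈ seq F G ↔ ∃ v, ((u, fstL k n n' x), (v, fstL k n n' z)) ∈ F ∧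
      ((v, sndL k n n' x), (y, sndL k n n' z)) ∈ G := Iff.rfl

theorem mem_sum {m p m' p' n n' : ℕ} {F : StateRel k n m p} {G : StateRel k n' m' p'}
    {u : Fin (m + m') → k} {x : Fin (n + n') → k} {y : Fin (p + p') → k}
    {z : Fin (n + n') → k} :
    ((u, x), (y, z)) ∈ sum F G ↔
      ((fstL k m m' u, fstL k n n' x), (fstL k p p' y, fstL k n n' z)) ∈ F ∧
      ((sndL k m m' u, sndL k n n' x), (sndL k p p' y, sndL k n n' z)) ∈ G := Iff.rfl

/-- Equality up to an isomorphism of the state spaces and renumberings of the inputs and of the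
outputs. -/
def Equiv {m p m' p' n n' : ℕ} (hm : m = m') (hp : p = p') (F : StateRel k n m p)
    (G : StateRel k n' m' p') : Prop :=
  ∃ σ : (Fin n → k) ≃ₗ[k] (Fin n' → k), ∀ u x y z,
    ((u, x), (y, z)) ∈ F ↔ ((castL k hm u, σ x), (castL k hp y, σ z)) ∈ G

/-! ### The laws of a PROP for state relations, up to isomorphism of the state space. -/

section Equiv

variable {l m p q l' m' p' n n' n'' r r' r'' : ℕ}

theorem Equiv.refl (F : StateRel k n m p) : Equiv rfl rfl F F :=
  ⟨.refl k _, fun _ _ _ _ => Iff.rfl⟩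

theorem Equiv.of_eq {F G : StateRel k n m p} (h : F = G) : Equiv rfl rfl F G := h ▸ .refl F

theorem Equiv.symm {F : StateRel k n m p} {G : StateRel k n' m p} (h : Equiv rfl rfl F G) :
    Equiv rfl rfl G F := by
  obtain ⟨σ, h⟩ := h
  refine ⟨σ.symm, fun u x y z => ?_⟩
  simpa using (h u (σ.symm x) y (σ.symm z)).symm

theorem Equiv.trans {F : StateRel k n m p} {G : StateRel k n' m p} {H : StateRel k n'' m p}
    (h : Equiv rfl rfl F G) (h' : Equiv rfl rfl G H) : Equiv rfl rfl F H := by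
  obtain ⟨σ, h⟩ := h
  obtain ⟨σ', h'⟩ := h'
  exact ⟨σ.trans σ', fun u x y z => (h u x y z).trans (h' _ _ _ _)⟩

theorem Equiv.seq {F : StateRel k n l m} {F' : StateRel k n' l m} {G : StateRel k r m p}
    {G' : StateRel k r' m p} (h : Equiv rfl rfl F F') (h' : Equiv rfl rfl G G') :
    Equiv rfl rfl (F.seq G) (F'.seq G') := by
  obtain ⟨σ, h⟩ := h
  obtain ⟨σ', h'⟩ := h'
  refine ⟨sumE σ σ', fun u x y z => ?_⟩
  simp only [mem_seq, h, h', castL_rfl, fstL_sumE, sndL_sumE]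

theorem Equiv.sum {F : StateRel k n m p} {F' : StateRel k n' m p} {G : StateRel k r m' p'}
    {G' : StateRel k r' m' p'} (h : Equiv rfl rfl F F') (h' : Equiv rfl rfl G G') :
    Equiv rfl rfl (F.sum G) (F'.sum G') := by
  obtain ⟨σ, h⟩ := h
  obtain ⟨σ', h'⟩ := h'
  refine ⟨sumE σ σ', fun u x y z => ?_⟩
  simp only [mem_sum, h, h', castL_rfl, fstL_sumE, sndL_sumE]

theorem ofRel_seq (R : Submodule k ((Fin l → k) × (Fin m → k)))
    (S : Submodule k ((Fin m → k) × (Fin p → k))) :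
    Equiv rfl rfl ((ofRel R).seq (ofRel S)) (ofRel (relComp R S)) :=
  ⟨.refl k (Fin 0 → k), fun _ _ _ _ => Iff.rfl⟩

theorem ofRel_sum (R : Submodule k ((Fin m → k) × (Fin p → k)))
    (S : Submodule k ((Fin m' → k) × (Fin p' → k))) :
    Equiv rfl rfl ((ofRel R).sum (ofRel S)) (ofRel (relSum R S)) :=
  ⟨.refl k (Fin 0 → k), fun _ _ _ _ => Iff.rfl⟩

theorem id_seq (F : StateRel k n m p) :
    Equiv rfl rfl ((ofRel (LinearMap.id : (Fin m → k) →ₗ[k] (Fin m → k)).graph).seq F) F := by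
  refine ⟨castL k (zero_add _), fun u x y z => ?_⟩
  simp [mem_seq, mem_ofRel, castL_zero_add]

theorem seq_id (F : StateRel k n m p) :
    Equiv rfl rfl (F.seq (ofRel (LinearMap.id : (Fin p → k) →ₗ[k] (Fin p → k)).graph)) F := by
  -- `n + 0` reduces to `n`, so no renumbering of the state is needed here; for `0 + n` in `id_seq`
  -- it is.
  refine ⟨.refl k _, fun u x y z => ?_⟩
  refine mem_seq.trans ?_
  simp only [mem_ofRel, mem_graph, fstL_add_zero]
  exact ⟨fun ⟨v, h, hv⟩ => hv ▸ h, fun h => ⟨y, h, rfl⟩⟩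

theorem seq_assoc (F : StateRel k n l m) (G : StateRel k n' m p) (H : StateRel k n'' p q) :
    Equiv rfl rfl ((F.seq G).seq H) (F.seq (G.seq H)) := by
  refine ⟨castL k (add_assoc _ _ _), fun u x y z => ?_⟩
  simp only [mem_seq, fstL_castL_assoc, fst_sndL_castL_assoc, snd_sndL_castL_assoc, castL_rfl]
  constructor
  · rintro ⟨v, ⟨w, h₁, h₂⟩, h₃⟩
    exact ⟨w, h₁, v, h₂, h₃⟩
  · rintro ⟨w, h₁, v, h₂, h₃⟩
    exact ⟨v, ⟨w, h₁, h₂⟩, h₃⟩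

/-- The two sides list the four groups of integrators in different orders: first `F`, `G`, `F'`,
`G'`, then `F`, `F'`, `G`, `G'`. Strict equality fails, and the exchange of the middle blocks
repairs this. -/
theorem sum_seq (F : StateRel k n l m) (G : StateRel k r m p) (F' : StateRel k n' l' m')
    (G' : StateRel k r' m' p') :
    Equiv rfl rfl ((F.seq G).sum (F'.seq G')) ((F.sum F').seq (G.sum G')) := by
  refine ⟨midE k _ _ _ _, fun u x y z => ?_⟩
  simp only [mem_seq, mem_sum, fst_fstL_midE, snd_fstL_midE, fst_sndL_midE, snd_sndL_midE,
    castL_rfl]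
  constructor
  · rintro ⟨⟨v, h₁, h₂⟩, w, h₃, h₄⟩
    refine ⟨pairL (LinearMap.fst k _ _) (LinearMap.snd k _ _) (v, w), ⟨?_, ?_⟩, ?_, ?_⟩ <;>
      simpa
  · rintro ⟨v, ⟨h₁, h₂⟩, h₃, h₄⟩
    exact ⟨⟨_, h₁, h₃⟩, _, h₂, h₄⟩

theorem sum_assoc {m'' p'' : ℕ} (F : StateRel k n m p) (G : StateRel k n' m' p')
    (H : StateRel k n'' m'' p'') :
    Equiv (add_assoc _ _ _) (add_assoc _ _ _) ((F.sum G).sum H) (F.sum (G.sum H)) := by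
  refine ⟨castL k (add_assoc _ _ _), fun u x y z => ?_⟩
  simp only [mem_sum, fstL_castL_assoc, fst_sndL_castL_assoc, snd_sndL_castL_assoc, and_assoc]

theorem id_zero_sum (F : StateRel k n m p) :
    Equiv (zero_add _) (zero_add _)
      ((ofRel (LinearMap.id : (Fin 0 → k) →ₗ[k] (Fin 0 → k)).graph).sum F) F := by
  refine ⟨castL k (zero_add _), fun u x y z => ?_⟩
  simp only [mem_sum, castL_zero_add]
  exact and_iff_right (Subsingleton.elim (α := Fin 0 → k) _ _)

theorem sum_id_zero (F : StateRel k n m p) :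
    Equiv (add_zero _) (add_zero _)
      (F.sum (ofRel (LinearMap.id : (Fin 0 → k) →ₗ[k] (Fin 0 → k)).graph)) F :=
  ⟨.refl k _, fun _ _ _ _ => and_iff_left (Subsingleton.elim (α := Fin 0 → k) _ _)⟩

theorem swap_natural (F : StateRel k n m p) (G : StateRel k n' m' p') :
    Equiv rfl rfl ((F.sum G).seq (ofRel (swapL k p p').graph))
      ((ofRel (swapL k m m').graph).seq (G.sum F)) := by
  -- The two groups of integrators change places, and the empty state of the symmetry moves from the
  -- end to the front. Only these two block equations of the isomorphism are used afterwards.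
  obtain ⟨σ, hσ, hσ'⟩ : ∃ σ : (Fin (n + n' + 0) → k) ≃ₗ[k] (Fin (0 + (n' + n)) → k),
      (∀ x, fstL k n' n (sndL k 0 (n' + n) (σ x)) = sndL k n n' (fstL k (n + n') 0 x)) ∧
      ∀ x, sndL k n' n (sndL k 0 (n' + n) (σ x)) = fstL k n n' (fstL k (n + n') 0 x) :=
    ⟨(swapE k n n').trans (castL k (zero_add (n' + n)).symm),
      fun x => (congrArg (fstL k n' n) (sndL_zero_add (zero_add (n' + n)) _)).trans (fstL_swapE _),
      fun x => (congrArg (sndL k n' n) (sndL_zero_add (zero_add (n' + n)) _)).trans (sndL_swapE _)⟩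
  refine ⟨σ, fun u x y z => ?_⟩
  simp only [mem_seq, mem_sum, mem_ofRel, mem_graph, castL_rfl, hσ, hσ', exists_eq_left]
  constructor
  · rintro ⟨v, ⟨h₁, h₂⟩, rfl⟩
    simpa [swapL] using ⟨h₂, h₁⟩
  · rintro ⟨h₁, h₂⟩
    -- The intermediate vector is forced: its exchange has to be `y`.
    refine ⟨swapL k _ _ y, ⟨?_, ?_⟩, ?_⟩
    · simpa [swapL] using h₂
    · simpa [swapL] using h₁
    · refine vec_ext ?_ ?_ <;> simp [swapL]

end Equiv

end StateRel

/-! ### The relation of a diagram with its integrators removed -/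

/-- The linear relation that a diagram with its integrators removed stands for. -/
def Term.stateRel : ∀ {m p : ℕ} (t : Term (GenInt k) m p), StateRel k t.ints m p
  | _, _, .id n => .ofRel ((FinRel k).id n)
  | _, _, .braid m n => .ofRel ((FinRel k).braid m n)
  | _, _, .gen (.base g) => .ofRel g.rel
  | _, _, .gen .int => .int
  | _, _, .comp f g => f.stateRel.seq g.stateRel
  | _, _, .tensor f g => f.stateRel.sum g.stateRel

/-- Serves the associativity and unit laws of the monoidal product, whose sides are compared through
`castHom`: the renumbering of outer wires in `StateRel.Equiv` is absorbed into the transported term.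
-/
theorem Term.stateRel_castHom {m p m' p' n : ℕ} (hm : m = m') (hp : p = p')
    (t : Term (GenInt k) m p) {F : StateRel k n m' p'}
    (h : StateRel.Equiv hm hp t.stateRel F) :
    StateRel.Equiv rfl rfl (castHom hm hp t).stateRel F := by
  subst hm hp; exact h

theorem Term.stateRel_castHom_ofRel {m p m' p' : ℕ} (hm : m = m') (hp : p = p')
    (t : Term (GenInt k) m p) {R : (FinRel k).Hom m p}
    (h : StateRel.Equiv rfl rfl t.stateRel (.ofRel R)) :
    StateRel.Equiv rfl rfl (castHom hm hp t).stateRel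
      (.ofRel (castHom (H := (FinRel k).Hom) hm hp R)) := by
  subst hm hp; exact h

/-- The laws of a PROP only change the relation of a diagram by an isomorphism of the state
space. -/
theorem Term.Rel.stateRel_equiv {m p : ℕ} {t t' : Term (GenInt k) m p} (h : Term.Rel t t') :
    StateRel.Equiv rfl rfl t.stateRel t'.stateRel := by
  induction h with
  | refl f => exact .refl _
  | symm _ ih => exact ih.symm
  | trans _ _ ih ih' => exact ih.trans ih'
  | comp _ _ ih ih' => exact ih.seq ih'
  | tensor _ _ ih ih' => exact ih.sum ih'
  | id_comp f => exact StateRel.id_seq _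
  | comp_id f => exact StateRel.seq_id _
  | assoc f g h => exact StateRel.seq_assoc _ _ _
  | tensor_id m n =>
    exact (StateRel.ofRel_sum _ _).trans
      (.of_eq (congrArg StateRel.ofRel ((FinRel k).tensor_id m n)))
  | tensor_comp f g f' g' => exact StateRel.sum_seq _ _ _ _
  | tensor_assoc f g h => exact Term.stateRel_castHom _ _ _ (StateRel.sum_assoc _ _ _)
  | id_zero_tensor f => exact Term.stateRel_castHom _ _ _ (StateRel.id_zero_sum _)
  | tensor_id_zero f => exact Term.stateRel_castHom _ _ _ (StateRel.sum_id_zero _)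
  | braid_natural f g => exact StateRel.swap_natural _ _
  | braid_braid m n =>
    exact (StateRel.ofRel_seq _ _).trans
      (.of_eq (congrArg StateRel.ofRel ((FinRel k).braid_braid m n)))
  | hexagon m n p =>
    -- No integrator occurs in the hexagon, so each factor is reduced to a relation without state,
    -- and the law in `FinRel k` finishes.
    refine (StateRel.Equiv.seq
      (Term.stateRel_castHom_ofRel _ _ (.tensor (.braid m n) (.id p))
        (StateRel.ofRel_sum ((FinRel k).braid m n) ((FinRel k).id p)))
      (Term.stateRel_castHom_ofRel _ _ (.tensor (.id n) (.braid m p))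
        (StateRel.ofRel_sum ((FinRel k).id n) ((FinRel k).braid m p)))).trans ?_
    exact (StateRel.ofRel_seq _ _).trans
      (.of_eq (congrArg StateRel.ofRel ((FinRel k).hexagon m n p)))

/-! ### The black box of a cut diagram -/

theorem PROPHom.map_castHom {P Q : PROP.{u}} (F : PROPHom P Q) {m n m' n' : ℕ} (hm : m = m')
    (hn : n = n') (f : P.Hom m n) : F.map (castHom hm hn f) = castHom hm hn (F.map f) := by
  subst hm hn; rfl

/-- Membership of a pair of vectors in the black box of a diagram without integrators. -/
def Holds {m n : ℕ} (f : (SigFlow k).Hom m n) (u : Fin m → k) (w : Fin n → k) : Prop :=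
  (u, w) ∈ (show Submodule k _ from (blackBoxConst k).map f)

section Holds

variable {l m n p m' n' : ℕ}

theorem holds_id {u w : Fin n → k} : Holds ((SigFlow k).id n) u w ↔ w = u := mem_graph

theorem holds_braid {u : Fin (m + n) → k} {w : Fin (n + m) → k} :
    Holds ((SigFlow k).braid m n) u w ↔ fstL k n m w = sndL k m n u ∧
      sndL k n m w = fstL k m n u := by
  refine (mem_graph (f := swapL k m n)).trans ?_
  simp [swapL, vec_ext_iff]

theorem holds_gen (g : Gen k m n) {u : Fin m → k} {w : Fin n → k} :
    Holds (Term.gen g).mk u w ↔ (u, w) ∈ (show Submodule k _ from g.rel) := Iff.rfl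

theorem holds_comp {f : (SigFlow k).Hom l m} {g : (SigFlow k).Hom m n} {u : Fin l → k}
    {w : Fin n → k} : Holds ((SigFlow k).comp f g) u w ↔ ∃ v, Holds f u v ∧ Holds g v w := by
  unfold Holds
  rw [(blackBoxConst k).map_comp]
  exact mem_relComp

theorem holds_tensor {f : (SigFlow k).Hom m n} {g : (SigFlow k).Hom m' n'}
    {u : Fin (m + m') → k} {w : Fin (n + n') → k} : Holds ((SigFlow k).tensor f g) u w ↔
      Holds f (fstL k m m' u) (fstL k n n' w) ∧ Holds g (sndL k m m' u) (sndL k n n' w) := by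
  unfold Holds
  rw [(blackBoxConst k).map_tensor]
  exact mem_relSum

theorem holds_castHom {hm : m = m'} {hn : n = n'} {f : (SigFlow k).Hom m n} {u : Fin m' → k}
    {w : Fin n' → k} : Holds (castHom hm hn f) u w ↔
      Holds f (castL k hm.symm u) (castL k hn.symm w) := by
  unfold Holds
  rw [(blackBoxConst k).map_castHom]
  exact castHom_rel hm hn _ u w

/-- Exchange of the last two blocks of a vector. -/
def lastL (k : Type u) [Field k] (l m n : ℕ) :
    (Fin (l + m + n) → k) →ₗ[k] (Fin (l + n + m) → k) :=
  pairL (pairL (fstL k l m ∘ₗ fstL k (l + m) n) (sndL k (l + m) n))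
    (sndL k l m ∘ₗ fstL k (l + m) n)

theorem holds_swapLast {u : Fin (l + m + n) → k} {w : Fin (l + n + m) → k} :
    Holds ((SigFlow k).swapLast l m n) u w ↔ w = lastL k l m n u := by
  refine holds_castHom.trans (holds_tensor.trans ?_)
  simp only [holds_id, holds_braid, fstL_castL_assoc, fst_sndL_castL_assoc,
    snd_sndL_castL_assoc, vec_ext_iff (m := l + n), vec_ext_iff (m := l), lastL, fstL_pairL,
    sndL_pairL, LinearMap.comp_apply]
  tauto

theorem fst_sndL_castL_mid {a b c d : ℕ} (h : (a + b) + (c + d) = a + (b + c) + d)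
    (x : Fin ((a + b) + (c + d)) → k) :
    sndL k b c (sndL k a (b + c) (fstL k (a + (b + c)) d (castL k h x)))
      = fstL k c d (sndL k (a + b) (c + d) x) := by
  ext i
  exact congrArg x (Fin.ext (by simp [add_assoc]))

theorem snd_sndL_castL_mid {a b c d : ℕ} (h : (a + b) + (c + d) = a + (b + c) + d)
    (x : Fin ((a + b) + (c + d)) → k) :
    sndL k (a + (b + c)) d (castL k h x) = sndL k c d (sndL k (a + b) (c + d) x) := by
  ext i
  exact congrArg x (Fin.ext (by simp [add_assoc]))

theorem fst_fstL_castL_mid {a b c d : ℕ} (h : (a + b) + (c + d) = a + (b + c) + d)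
    (x : Fin ((a + b) + (c + d)) → k) :
    fstL k a (b + c) (fstL k (a + (b + c)) d (castL k h x))
      = fstL k a b (fstL k (a + b) (c + d) x) := rfl

theorem snd_fstL_castL_mid {a b c d : ℕ} (h : (a + b) + (c + d) = a + (b + c) + d)
    (x : Fin ((a + b) + (c + d)) → k) :
    fstL k b c (sndL k a (b + c) (fstL k (a + (b + c)) d (castL k h x)))
      = sndL k a b (fstL k (a + b) (c + d) x) := rfl

theorem holds_swapMid {u : Fin ((l + m) + (n + p)) → k} {w : Fin ((l + n) + (m + p)) → k} :
    Holds ((SigFlow k).swapMid l m n p) u w ↔ w = midL k l m n p u := by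
  refine holds_castHom.trans (holds_tensor.trans (and_congr_left' holds_tensor |>.trans ?_))
  simp only [holds_id, holds_braid, fst_fstL_castL_mid, snd_fstL_castL_mid, fst_sndL_castL_mid,
    snd_sndL_castL_mid, vec_ext_iff (m := l + n), vec_ext_iff (m := l), vec_ext_iff (m := m),
    midL, sumL, fstL_pairL, sndL_pairL, LinearMap.comp_apply]
  tauto

theorem holds_zeroAll {u : Fin 0 → k} {w : Fin n → k} : Holds (zeroAll k n) u w ↔ w = 0 := by
  induction n with
  | zero => exact iff_of_true (Subsingleton.elim _ _) (Subsingleton.elim _ _)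
  | succ n ih =>
    refine holds_castHom.trans (holds_tensor.trans ?_)
    refine Iff.trans (and_congr ?_ ?_) (vec_ext_iff (m := n) (n := 1) (x := w) (y := 0)).symm
    · rw [map_zero]
      exact ih
    · rw [map_zero]
      exact mem_graph (f := (0 : (Fin 0 → k) →ₗ[k] (Fin 1 → k)))

theorem holds_delAll {u : Fin n → k} {w : Fin 0 → k} : Holds (delAll k n) u w := by
  induction n with
  | zero => exact holds_id.2 (Subsingleton.elim _ _)
  | succ n ih =>
    refine (holds_castHom.trans holds_tensor).2 ⟨ih, ?_⟩
    exact (mem_graph (f := (0 : (Fin 1 → k) →ₗ[k] (Fin 0 → k)))).2 (Subsingleton.elim _ _)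

end Holds

/-- The vector with the given blocks. -/
def glue {m n : ℕ} (u : Fin m → k) (v : Fin n → k) : Fin (m + n) → k :=
  pairL (LinearMap.fst k _ _) (LinearMap.snd k _ _) (u, v)

@[simp] theorem fstL_glue {m n : ℕ} (u : Fin m → k) (v : Fin n → k) :
    fstL k m n (glue u v) = u := fstL_pairL _ _ _

@[simp] theorem sndL_glue {m n : ℕ} (u : Fin m → k) (v : Fin n → k) :
    sndL k m n (glue u v) = v := sndL_pairL _ _ _

/-! ### Cutting a composite or a direct sum of diagrams. -/

section Cut

variable {l m p n n' m' p' : ℕ}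

/-- The first exchange of wires brings the integrator outputs needed by `g` next to the middle
wires, past the integrator inputs already produced by `f`. The second restores the order of the
states, `f` before `g`, which is the order in `StateRel.seq`. -/
theorem holds_cut_comp {F : StateRel k n l m} {G : StateRel k n' m p}
    {f : (SigFlow k).Hom (l + n) (m + n)} {g : (SigFlow k).Hom (m + n') (p + n')}
    (hf : ∀ w w', Holds f w w' ↔ ((fstL k l n w, sndL k l n w), (fstL k m n w', sndL k m n w')) ∈ F)
    (hg : ∀ w w', Holds g w w' ↔
      ((fstL k m n' w, sndL k m n' w), (fstL k p n' w', sndL k p n' w')) ∈ G)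
    (w : Fin (l + (n + n')) → k) (w' : Fin (p + (n + n')) → k) :
    Holds (castHom (add_assoc l n n') (add_assoc p n n')
      ((SigFlow k).comp
        ((SigFlow k).comp ((SigFlow k).tensor f ((SigFlow k).id n')) ((SigFlow k).swapLast m n n'))
        ((SigFlow k).comp ((SigFlow k).tensor g ((SigFlow k).id n))
          ((SigFlow k).swapLast p n' n)))) w w' ↔
      ((fstL k l (n + n') w, sndL k l (n + n') w), (fstL k p (n + n') w', sndL k p (n + n') w'))
        ∈ F.seq G := by
  simp only [holds_castHom, holds_comp, holds_tensor, holds_swapLast, holds_id, hf, hg,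
    StateRel.mem_seq, fst_fstL_castL_assoc, snd_fstL_castL_assoc, sndL_castL_assoc, lastL,
    vec_ext_iff (m := p + n), vec_ext_iff (m := p), fstL_pairL, sndL_pairL, LinearMap.comp_apply]
  constructor
  · rintro ⟨a, ⟨b, ⟨hb, hb'⟩, rfl⟩, c, ⟨hc, hc'⟩, ⟨h₁, h₂⟩, h₃⟩
    simp only [fstL_pairL, sndL_pairL, LinearMap.comp_apply] at hc hc'
    refine ⟨fstL k m n (fstL k (m + n) n' b), ?_, ?_⟩
    · rw [h₂, hc']; exact hb
    · rw [h₁, h₃, ← hb']; exact hc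
  · rintro ⟨v, h₁, h₂⟩
    -- After `f` the wires carry the middle signal `v`, the inputs of the integrators of `f` and the
    -- outputs of those of `g`. After `g` they carry the outer output, the inputs of the integrators
    -- of `g` and then those of `f`.
    refine ⟨_, ⟨glue (glue v (fstL k n n' (sndL k p (n + n') w')))
      (sndL k n n' (sndL k l (n + n') w)), ⟨?_, ?_⟩, rfl⟩,
      glue (glue (fstL k p (n + n') w') (sndL k n n' (sndL k p (n + n') w')))
        (fstL k n n' (sndL k p (n + n') w')), ⟨?_, ?_⟩, ⟨?_, ?_⟩, ?_⟩
    · simpa using h₁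
    · simp
    · simpa using h₂
    all_goals simp

theorem holds_cut_tensor {F : StateRel k n m p} {G : StateRel k n' m' p'}
    {f : (SigFlow k).Hom (m + n) (p + n)} {g : (SigFlow k).Hom (m' + n') (p' + n')}
    (hf : ∀ w w', Holds f w w' ↔ ((fstL k m n w, sndL k m n w), (fstL k p n w', sndL k p n w')) ∈ F)
    (hg : ∀ w w', Holds g w w' ↔
      ((fstL k m' n' w, sndL k m' n' w), (fstL k p' n' w', sndL k p' n' w')) ∈ G)
    (w : Fin ((m + m') + (n + n')) → k) (w' : Fin ((p + p') + (n + n')) → k) :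
    Holds ((SigFlow k).comp
      ((SigFlow k).comp ((SigFlow k).swapMid m m' n n') ((SigFlow k).tensor f g))
      ((SigFlow k).swapMid p n p' n')) w w' ↔
      ((fstL k _ _ w, sndL k _ _ w), (fstL k _ _ w', sndL k _ _ w')) ∈ F.sum G := by
  simp only [holds_comp, holds_tensor, holds_swapMid, hf, hg, StateRel.mem_sum]
  constructor
  · rintro ⟨a, ⟨b, rfl, h₁, h₂⟩, rfl⟩
    simp only [midL, sumL, fstL_pairL, sndL_pairL, LinearMap.comp_apply] at h₁ h₂ ⊢
    exact ⟨h₁, h₂⟩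
  · rintro ⟨h₁, h₂⟩
    refine ⟨midL k p p' n n' w', ⟨_, rfl, ?_⟩, ?_⟩
    · simp only [midL, sumL, fstL_pairL, sndL_pairL, LinearMap.comp_apply]
      exact ⟨h₁, h₂⟩
    · refine vec_ext (vec_ext ?_ ?_) (vec_ext ?_ ?_) <;> simp [midL, sumL]

end Cut

/-- Bridge from the wiring of `Term.cut` to the recursively defined behaviour. Terms without
integrators carry an empty extra block, on which every condition is vacuous; for an integrator the
two crossing wires say `y = x` and `z = u`, which is `StateRel.int`. -/
theorem Term.holds_cut {m p : ℕ} (t : Term (GenInt k) m p) (w : Fin (m + t.ints) → k)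
    (w' : Fin (p + t.ints) → k) : Holds t.cut w w' ↔
      ((fstL k m t.ints w, sndL k m t.ints w), (fstL k p t.ints w', sndL k p t.ints w'))
        ∈ t.stateRel := by
  induction t with
  | id n => exact holds_tensor.trans (and_iff_left (holds_id.2 (Subsingleton.elim (α := Fin 0 → k) _ _)))
  | braid m n => exact holds_tensor.trans (and_iff_left (holds_id.2 (Subsingleton.elim (α := Fin 0 → k) _ _)))
  | gen g =>
    cases g with
    | base g => exact holds_tensor.trans (and_iff_left (holds_id.2 (Subsingleton.elim (α := Fin 0 → k) _ _)))
    | int => exact holds_braid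
  | comp f g hf hg => exact holds_cut_comp hf hg w w'
  | tensor f g hf hg => exact holds_cut_tensor hf hg w w'

/-! ### The relations `A`, `B`, `C`, `D` in terms of the state relation -/

theorem sndL_castL_zero_add {m : ℕ} (h : m = 0 + m) (x : Fin m → k) :
    sndL k 0 m (castL k h x) = x := sndL_zero_add h.symm x

theorem fstL_castL_add_zero {m : ℕ} (h : m = m + 0) (x : Fin m → k) :
    fstL k m 0 (castL k h x) = x := rfl

/-- Capping inputs with `0` sets the corresponding block to zero, and deleting outputs quantifies
them existentially. The same reading gives `mem_relB` and `mem_relC`. -/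
theorem mem_relA {m p : ℕ} {t : Term (GenInt k) m p} {x z : Fin t.ints → k} :
    (x, z) ∈ (show Submodule k _ from relA t) ↔ ∃ y, ((0, x), (y, z)) ∈ t.stateRel := by
  refine holds_castHom.trans ?_
  simp only [holds_comp, holds_tensor, holds_id, holds_zeroAll, holds_delAll, Term.holds_cut,
    sndL_castL_zero_add, true_and]
  constructor
  · rintro ⟨a, ⟨b, ⟨h₁, h₂⟩, h⟩, h₃⟩
    rw [h₁, h₂, ← h₃] at h
    exact ⟨_, h⟩
  · rintro ⟨y, h⟩
    exact ⟨glue y z, ⟨glue 0 x, by simp, by simpa⟩, by simp⟩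

theorem mem_relB {m p : ℕ} {t : Term (GenInt k) m p} {u : Fin m → k} {z : Fin t.ints → k} :
    (u, z) ∈ (show Submodule k _ from relB t) ↔ ∃ y, ((u, 0), (y, z)) ∈ t.stateRel := by
  refine holds_castHom.trans ?_
  simp only [holds_comp, holds_tensor, holds_id, holds_zeroAll, holds_delAll, Term.holds_cut,
    sndL_castL_zero_add, fstL_castL_add_zero, true_and]
  constructor
  · rintro ⟨a, ⟨b, ⟨h₁, h₂⟩, h⟩, h₃⟩
    rw [h₁, h₂, ← h₃] at h
    exact ⟨_, h⟩
  · rintro ⟨y, h⟩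
    exact ⟨glue y z, ⟨glue u 0, by simp, by simpa⟩, by simp⟩

theorem mem_relC {m p : ℕ} {t : Term (GenInt k) m p} {x : Fin t.ints → k} {y : Fin p → k} :
    (x, y) ∈ (show Submodule k _ from relC t) ↔ ∃ z, ((0, x), (y, z)) ∈ t.stateRel := by
  refine holds_castHom.trans ?_
  simp only [holds_comp, holds_tensor, holds_id, holds_zeroAll, holds_delAll, Term.holds_cut,
    sndL_castL_zero_add, fstL_castL_add_zero, and_true]
  constructor
  · rintro ⟨a, ⟨b, ⟨h₁, h₂⟩, h⟩, h₃⟩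
    rw [h₁, h₂, ← h₃] at h
    exact ⟨_, h⟩
  · rintro ⟨z, h⟩
    exact ⟨glue y z, ⟨glue 0 x, by simp, by simpa⟩, by simp⟩

/-- The block of `z` belonging to `F` and the one belonging to `G` are constrained separately, so
once `v` is fixed the quantifier over `z` splits. This is the composition step for `D`. -/
theorem StateRel.exists_mem_seq_zero {l m p n n' : ℕ} {F : StateRel k n l m}
    {G : StateRel k n' m p} {u : Fin l → k} {y : Fin p → k} :
    (∃ z, ((u, 0), (y, z)) ∈ F.seq G) ↔
      ∃ v, (∃ z, ((u, 0), (v, z)) ∈ F) ∧ ∃ z, ((v, 0), (y, z)) ∈ G := by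
  simp only [mem_seq, map_zero]
  constructor
  · rintro ⟨z, v, h, h'⟩
    exact ⟨v, ⟨_, h⟩, _, h'⟩
  · rintro ⟨v, ⟨z, h⟩, z', h'⟩
    exact ⟨glue z z', v, by simpa using h, by simpa using h'⟩

theorem StateRel.exists_mem_sum_zero {m p m' p' n n' : ℕ} {F : StateRel k n m p}
    {G : StateRel k n' m' p'} {u : Fin (m + m') → k} {y : Fin (p + p') → k} :
    (∃ z, ((u, 0), (y, z)) ∈ F.sum G) ↔
      (∃ z, ((fstL k m m' u, 0), (fstL k p p' y, z)) ∈ F) ∧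
        ∃ z, ((sndL k m m' u, 0), (sndL k p p' y, z)) ∈ G := by
  simp only [mem_sum, map_zero]
  constructor
  · rintro ⟨z, h, h'⟩
    exact ⟨⟨_, h⟩, _, h'⟩
  · rintro ⟨⟨z, h⟩, z', h'⟩
    exact ⟨glue z z', by simpa using h, by simpa using h'⟩

/-- Replacing an integrator by `s_0` amounts to feeding `0` into the wire that left it and ignoring
what enters it. So `D` is a slice of the same subspace as `A`, `B` and `C`, although it is defined
without cutting. -/
theorem Term.holds_scaleZero {m p : ℕ} (t : Term (GenInt k) m p) {u : Fin m → k}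
    {y : Fin p → k} : Holds (t.eval (SigFlow k) (fun g => g.scaleZero)) u y ↔
      ∃ z, ((u, 0), (y, z)) ∈ t.stateRel := by
  induction t with
  | id n => exact holds_id.trans ⟨fun h => ⟨0, mem_graph.2 h⟩, fun ⟨_, h⟩ => mem_graph.1 h⟩
  | braid m n =>
    exact ⟨fun h => ⟨0, h⟩, fun ⟨_, h⟩ => h⟩
  | gen g =>
    cases g with
    | base g => exact ⟨fun h => ⟨0, h⟩, fun ⟨_, h⟩ => h⟩
    | int =>
      refine (holds_gen (.scale (0 : k))).trans (mem_graph.trans ?_)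
      rw [zero_smul]
      -- The signal entering the integrator is its input `u`, which is the only possible witness.
      exact ⟨fun h => ⟨u, h, rfl⟩, fun ⟨_, h⟩ => h.1⟩
  | comp f g hf hg =>
    exact (holds_comp.trans (exists_congr fun v => and_congr hf hg)).trans
      StateRel.exists_mem_seq_zero.symm
  | tensor f g hf hg =>
    exact (holds_tensor.trans (and_congr hf hg)).trans StateRel.exists_mem_sum_zero.symm

theorem mem_relD {m p : ℕ} {t : Term (GenInt k) m p} {u : Fin m → k} {y : Fin p → k} :
    (u, y) ∈ (show Submodule k _ from relD t.mk) ↔ ∃ z, ((u, 0), (y, z)) ∈ t.stateRel :=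
  t.holds_scaleZero

/-! ### Extension of scalars for state relations -/

/-- A linear relation contains the graph of a linear map defined on all of its domain. -/
theorem exists_linear_selection {V W : Type u} [AddCommGroup V] [Module k V] [AddCommGroup W]
    [Module k W] (P : Submodule k (V × W)) :
    ∃ s : V →ₗ[k] W, ∀ v w, (v, w) ∈ P → (v, s v) ∈ P := by
  -- Over a field the projection of `P` onto its domain has a linear section. Its second component
  -- is a selection on the domain, which is then extended arbitrarily to all of `V`.
  obtain ⟨g, hg⟩ := (LinearMap.fst k V W ∘ₗ P.subtype).rangeRestrict.exists_rightInverse_of_surjective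
    (LinearMap.range_rangeRestrict _)
  obtain ⟨s, hs⟩ := LinearMap.exists_extend (LinearMap.snd k V W ∘ₗ P.subtype ∘ₗ g)
  refine ⟨s, fun v w h => ?_⟩
  have hv : v ∈ (LinearMap.fst k V W ∘ₗ P.subtype).range := ⟨⟨_, h⟩, rfl⟩
  have h₁ : (g ⟨v, hv⟩).1.1 = v := congrArg Subtype.val (LinearMap.congr_fun hg ⟨v, hv⟩)
  have h₂ : s v = (g ⟨v, hv⟩).1.2 := LinearMap.congr_fun hs ⟨v, hv⟩
  have h₃ := (g ⟨v, hv⟩).2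
  rw [h₂]
  convert h₃ using 1
  exact Prod.ext h₁.symm rfl

/-- The `k`-linear functionals on the `k`-vector space `k(s)` separate points. Applied
coordinatewise they turn vectors over `k(s)` into vectors over `k`, so equations over `k(s)` can be
checked over `k`. -/
theorem ratFunc_vec_ext {n : ℕ} {x y : Fin n → RatFunc k} :
    x = y ↔ ∀ φ : RatFunc k →ₗ[k] k, φ.compLeft (Fin n) x = φ.compLeft (Fin n) y := by
  refine ⟨fun h φ => by rw [h], fun h => funext fun i => sub_eq_zero.1 ?_⟩
  refine (Module.forall_dual_apply_eq_zero_iff k _).1 fun φ => ?_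
  rw [map_sub, sub_eq_zero]
  exact congrFun (h φ) i

theorem compLeft_extend {m n : ℕ} (f : (Fin m → k) →ₗ[k] (Fin n → k)) (φ : RatFunc k →ₗ[k] k)
    (x : Fin m → RatFunc k) :
    φ.compLeft (Fin n) (extend f x) = f (φ.compLeft (Fin m) x) := by
  ext i
  conv_rhs => rw [← LinearMap.toMatrix'_mulVec f]
  simp [extend, Matrix.mulVec, dotProduct, ← RatFunc.smul_eq_C_mul]

theorem compLeft_glue {m n : ℕ} (φ : RatFunc k →ₗ[k] k) (x : Fin m → RatFunc k)
    (y : Fin n → RatFunc k) :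
    φ.compLeft _ (glue x y) = glue (φ.compLeft _ x) (φ.compLeft _ y) := by
  refine vec_ext ?_ ?_
  · rw [fstL_glue]
    exact congrArg (φ.compLeft _) (fstL_glue x y)
  · rw [sndL_glue]
    exact congrArg (φ.compLeft _) (sndL_glue x y)

/-- A solution `v` may a priori depend on the functional `φ`. A linear selection `s` for `P`,
extended to `k(s)`, yields one vector that works for all `φ`, because maps defined over `k` commute
with every `φ`. It plays the role of exactness of extension of scalars. -/
theorem exists_extension_of_forall {m n : ℕ} (P : Submodule k ((Fin m → k) × (Fin n → k)))
    (w : Fin m → RatFunc k) (h : ∀ φ : RatFunc k →ₗ[k] k, ∃ v, (φ.compLeft _ w, v) ∈ P) :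
    ∃ v : Fin n → RatFunc k, ∀ φ : RatFunc k →ₗ[k] k, (φ.compLeft _ w, φ.compLeft _ v) ∈ P := by
  obtain ⟨s, hs⟩ := exists_linear_selection P
  refine ⟨extend s w, fun φ => ?_⟩
  obtain ⟨v, hv⟩ := h φ
  rw [compLeft_extend]
  exact hs _ _ hv

namespace StateRel

/-- Membership in the extension of scalars of a state relation to `k(s)`, tested by `k`-linear
functionals on `k(s)`. -/
def Ext {n m p : ℕ} (F : StateRel k n m p) (u : Fin m → RatFunc k) (x : Fin n → RatFunc k)
    (y : Fin p → RatFunc k) (z : Fin n → RatFunc k) : Prop :=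
  ∀ φ : RatFunc k →ₗ[k] k,
    ((φ.compLeft _ u, φ.compLeft _ x), (φ.compLeft _ y, φ.compLeft _ z)) ∈ F

variable {l m p m' p' n n' : ℕ}

/-- Only the forward direction has content: the middle vectors found for the individual functionals
must come from a single vector over `k(s)`. -/
theorem ext_seq {F : StateRel k n l m} {G : StateRel k n' m p} {u : Fin l → RatFunc k}
    {x : Fin (n + n') → RatFunc k} {y : Fin p → RatFunc k} {z : Fin (n + n') → RatFunc k} :
    (F.seq G).Ext u x y z ↔ ∃ v, F.Ext u (fstL _ n n' x) v (fstL _ n n' z) ∧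
      G.Ext v (sndL _ n n' x) y (sndL _ n n' z) := by
  constructor
  · intro h
    let π := LinearMap.fst k (Fin ((l + (n + n')) + (p + (n + n'))) → k) (Fin m → k)
    -- The boundary data `u`, `x`, `y`, `z` are glued into one vector, and `P` relates it to the
    -- admissible middle vectors `v`; this is the form in which selections apply.
    let P : Submodule k ((Fin ((l + (n + n')) + (p + (n + n'))) → k) × (Fin m → k)) :=
      F.comap (((fstL k _ _ ∘ₗ fstL k _ _ ∘ₗ π).prod (fstL k _ _ ∘ₗ sndL k _ _ ∘ₗ fstL k _ _ ∘ₗ π)).prod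
        ((LinearMap.snd k _ _).prod (fstL k _ _ ∘ₗ sndL k _ _ ∘ₗ sndL k _ _ ∘ₗ π))) ⊓
      G.comap (((LinearMap.snd k _ _).prod (sndL k _ _ ∘ₗ sndL k _ _ ∘ₗ fstL k _ _ ∘ₗ π)).prod
        ((fstL k _ _ ∘ₗ sndL k _ _ ∘ₗ π).prod (sndL k _ _ ∘ₗ sndL k _ _ ∘ₗ sndL k _ _ ∘ₗ π)))
    have hP : ∀ u x y z v, (glue (glue u x) (glue y z), v) ∈ P ↔
        ((u, fstL k n n' x), (v, fstL k n n' z)) ∈ F ∧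
          ((v, sndL k n n' x), (y, sndL k n n' z)) ∈ G := by
      intro u x y z v
      simp [P, π]
    obtain ⟨v, hv⟩ := exists_extension_of_forall P (glue (glue u x) (glue y z)) fun φ => by
      obtain ⟨v, hv⟩ := h φ
      exact ⟨v, by simpa only [compLeft_glue, hP] using hv⟩
    simp only [compLeft_glue, hP] at hv
    exact ⟨v, fun φ => (hv φ).1, fun φ => (hv φ).2⟩
  · rintro ⟨v, h, h'⟩ φ
    exact ⟨φ.compLeft _ v, h φ, h' φ⟩

theorem ext_sum {F : StateRel k n m p} {G : StateRel k n' m' p'}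
    {u : Fin (m + m') → RatFunc k} {x : Fin (n + n') → RatFunc k}
    {y : Fin (p + p') → RatFunc k} {z : Fin (n + n') → RatFunc k} : (F.sum G).Ext u x y z ↔
      F.Ext (fstL _ m m' u) (fstL _ n n' x) (fstL _ p p' y) (fstL _ n n' z) ∧
        G.Ext (sndL _ m m' u) (sndL _ n n' x) (sndL _ p p' y) (sndL _ n n' z) :=
  ⟨fun h => ⟨fun φ => (h φ).1, fun φ => (h φ).2⟩, fun h φ => ⟨h.1 φ, h.2 φ⟩⟩

/-- The linear relation over `k(s)` obtained when every integrator scales by `1 / s`. -/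
def Run (F : StateRel k n m p) (u : Fin m → RatFunc k) (y : Fin p → RatFunc k) : Prop :=
  ∃ x, F.Ext u x y ((RatFunc.X : RatFunc k) • x)

theorem run_ofRel {R : Submodule k ((Fin m → k) × (Fin p → k))} {u : Fin m → RatFunc k}
    {y : Fin p → RatFunc k} : (ofRel R).Run u y ↔
      ∀ φ : RatFunc k →ₗ[k] k, (φ.compLeft _ u, φ.compLeft _ y) ∈ R :=
  ⟨fun ⟨_, h⟩ => h, fun h => ⟨0, h⟩⟩

theorem run_ofRel_graph {f : (Fin m → k) →ₗ[k] (Fin p → k)}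
    {f' : (Fin m → RatFunc k) →ₗ[RatFunc k] (Fin p → RatFunc k)}
    (hf : ∀ (φ : RatFunc k →ₗ[k] k) u, φ.compLeft _ (f' u) = f (φ.compLeft _ u))
    {u : Fin m → RatFunc k} {y : Fin p → RatFunc k} :
    (u, y) ∈ f'.graph ↔ (ofRel f.graph).Run u y := by
  rw [run_ofRel, mem_graph, ratFunc_vec_ext]
  simp only [mem_graph, hf]

/-- Tested by functionals, the behaviour of the integrator says `y = x` and `s x = u`; eliminating
`x` uses that `s` is invertible in `k(s)`. -/
theorem run_int {u y : Fin 1 → RatFunc k} :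
    (int : StateRel k 1 1 1).Run u y ↔ y = (RatFunc.X : RatFunc k)⁻¹ • u := by
  have : (int : StateRel k 1 1 1).Run u y ↔ ∃ x, y = x ∧ (RatFunc.X : RatFunc k) • x = u := by
    simp only [ratFunc_vec_ext (x := y), ratFunc_vec_ext (y := u), ← forall_and]
    rfl
  rw [this, exists_eq_left', eq_inv_smul_iff₀ RatFunc.X_ne_zero]

/-- Closing the integrators with `z = s x` respects blocks, so the closure can be carried out
separately in `F` and in `G`. -/
theorem run_seq {F : StateRel k n l m} {G : StateRel k n' m p} {u : Fin l → RatFunc k}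
    {y : Fin p → RatFunc k} : (F.seq G).Run u y ↔ ∃ v, F.Run u v ∧ G.Run v y := by
  simp only [Run, ext_seq, map_smul]
  constructor
  · rintro ⟨x, v, h, h'⟩
    exact ⟨v, ⟨_, h⟩, _, h'⟩
  · rintro ⟨v, ⟨x, h⟩, x', h'⟩
    exact ⟨glue x x', v, by simpa using h, by simpa using h'⟩

theorem run_sum {F : StateRel k n m p} {G : StateRel k n' m' p'}
    {u : Fin (m + m') → RatFunc k} {y : Fin (p + p') → RatFunc k} : (F.sum G).Run u y ↔
      F.Run (fstL _ m m' u) (fstL _ p p' y) ∧ G.Run (sndL _ m m' u) (sndL _ p p' y) := by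
  simp only [Run, ext_sum, map_smul]
  constructor
  · rintro ⟨x, h, h'⟩
    exact ⟨⟨_, h⟩, _, h'⟩
  · rintro ⟨⟨x, h⟩, x', h'⟩
    exact ⟨glue x x', by simpa using h, by simpa using h'⟩

end StateRel

theorem Gen.mem_rel_map {m n : ℕ} (g : Gen k m n) {u : Fin m → RatFunc k}
    {y : Fin n → RatFunc k} :
    (u, y) ∈ (show Submodule _ _ from (g.map (fun c => (RatFunc.C c : RatFunc k))).rel) ↔
      (StateRel.ofRel g.rel).Run u y := by
  cases g with
  | add => exact StateRel.run_ofRel_graph fun φ u => funext fun i => map_add φ _ _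
  | zero => exact StateRel.run_ofRel_graph fun φ u => funext fun i => map_zero φ
  | dup => exact StateRel.run_ofRel_graph fun φ u => rfl
  | del => exact StateRel.run_ofRel_graph fun φ u => Subsingleton.elim _ _
  | cup =>
    refine Iff.trans ?_ StateRel.run_ofRel.symm
    -- `∪` is not the graph of a map, so `run_ofRel_graph` does not apply; its scalar equation is
    -- viewed as one between vectors of length one and tested by functionals.
    refine Iff.trans (b := (fun _ : Fin 1 => u 0) = fun _ => u 1) ?_ (ratFunc_vec_ext.trans ?_)
    · exact ⟨fun h => funext fun _ => h, fun h => congrFun h 0⟩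
    · exact forall_congr' fun φ => ⟨fun h => congrFun h 0, fun h => funext fun _ => h⟩
  | cap =>
    refine Iff.trans ?_ StateRel.run_ofRel.symm
    refine Iff.trans (b := (fun _ : Fin 1 => y 0) = fun _ => y 1) ?_ (ratFunc_vec_ext.trans ?_)
    · exact ⟨fun h => funext fun _ => h, fun h => congrFun h 0⟩
    · exact forall_congr' fun φ => ⟨fun h => congrFun h 0, fun h => funext fun _ => h⟩
  | scale c =>
    refine StateRel.run_ofRel_graph fun φ u => funext fun i => ?_
    change φ (RatFunc.C c * u i) = c * φ (u i)
    rw [← RatFunc.smul_eq_C_mul, map_smul, smul_eq_mul]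

/-- Valid for all diagrams, whether or not the extracted relations are maps; it reduces the black
box over `k(s)` to the behaviour over `k`. -/
theorem Term.mem_blackBox {m p : ℕ} (t : Term (GenInt k) m p) {u : Fin m → RatFunc k}
    {y : Fin p → RatFunc k} :
    (u, y) ∈ (show Submodule _ _ from (blackBox k).map t.mk) ↔ t.stateRel.Run u y := by
  induction t with
  | id n => exact StateRel.run_ofRel_graph fun φ u => rfl
  | braid m n =>
    refine StateRel.run_ofRel_graph fun φ u => ?_
    rw [← extend_swapL, compLeft_extend]
  | gen g =>
    cases g with
    | base g => exact g.mem_rel_map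
    | int => exact mem_graph.trans StateRel.run_int.symm
  | comp f g hf hg =>
    exact (mem_relComp.trans (exists_congr fun v => and_congr hf hg)).trans
      StateRel.run_seq.symm
  | tensor f g hf hg =>
    exact (mem_relSum.trans (and_congr hf hg)).trans StateRel.run_sum.symm

/-! ### State relations given by linear maps -/

namespace StateRel

variable {l m p m' p' n n' : ℕ}

/-- The state relation is the one of the equations `y = D u + C x`, `z = B u + A x`. -/
def Realizes (F : StateRel k n m p) (D : (Fin m → k) →ₗ[k] (Fin p → k))
    (C : (Fin n → k) →ₗ[k] (Fin p → k)) (A : (Fin n → k) →ₗ[k] (Fin n → k))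
    (B : (Fin m → k) →ₗ[k] (Fin n → k)) : Prop :=
  ∀ u x y z, ((u, x), (y, z)) ∈ F ↔ y = D u + C x ∧ z = B u + A x

/-- Four slices determine the whole subspace by superposition. A solution for `(u, x)` is the sum of
one for `(u, 0)` and one for `(0, x)`. Two solutions differ by one with zero inputs, which must
vanish because `C` and `A` send `0` to `0`. -/
theorem realizes_iff {F : StateRel k n m p} {D : (Fin m → k) →ₗ[k] (Fin p → k)}
    {C : (Fin n → k) →ₗ[k] (Fin p → k)} {A : (Fin n → k) →ₗ[k] (Fin n → k)}
    {B : (Fin m → k) →ₗ[k] (Fin n → k)} : F.Realizes D C A B ↔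
      (∀ x z, (∃ y, ((0, x), (y, z)) ∈ F) ↔ z = A x) ∧
      (∀ u z, (∃ y, ((u, 0), (y, z)) ∈ F) ↔ z = B u) ∧
      (∀ x y, (∃ z, ((0, x), (y, z)) ∈ F) ↔ y = C x) ∧
      ∀ u y, (∃ z, ((u, 0), (y, z)) ∈ F) ↔ y = D u := by
  constructor
  · intro h
    refine ⟨fun x z => ?_, fun u z => ?_, fun x y => ?_, fun u y => ?_⟩ <;>
      simp [h _ _ _ _]
  · rintro ⟨hA, hB, hC, hD⟩ u x y z
    have total : ((u, x), (D u + C x, B u + A x)) ∈ F := by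
      obtain ⟨y₁, h₁⟩ := (hA x _).2 rfl
      obtain ⟨y₂, h₂⟩ := (hB u _).2 rfl
      -- The slice for `A` supplies an element with some `y`; the slice for `C` determines that `y`.
      -- In the same way `B` supplies an element whose `y` is determined by `D`.
      obtain rfl := (hC _ _).1 ⟨_, h₁⟩
      obtain rfl := (hD _ _).1 ⟨_, h₂⟩
      simpa using F.add_mem h₂ h₁
    constructor
    · intro h
      have h₀ : ((0, 0), (y - (D u + C x), z - (B u + A x))) ∈ F := by
        have h' := F.sub_mem h total
        simp only [Prod.mk_sub_mk, sub_self] at h'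
        exact h'
      have hy := (hC _ _).1 ⟨_, h₀⟩
      have hz := (hA _ _).1 ⟨_, h₀⟩
      rw [map_zero, sub_eq_zero] at hy hz
      exact ⟨hy, hz⟩
    · rintro ⟨rfl, rfl⟩
      exact total

theorem realizes_ofRel (D : (Fin m → k) →ₗ[k] (Fin p → k)) :
    (ofRel D.graph).Realizes D 0 0 0 := fun u x y z => by
  rw [mem_ofRel, mem_graph, LinearMap.zero_apply, add_zero]
  exact (and_iff_left (Subsingleton.elim (α := Fin 0 → k) _ _)).symm

/-- Substitute `v = D u + C x` into the equations of `G`. The resulting matrices are exactly those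
of `statefulHom_comp`, which makes the functoriality of `lozenge` immediate. -/
theorem Realizes.seq {F : StateRel k n l m} {G : StateRel k n' m p}
    {D : (Fin l → k) →ₗ[k] (Fin m → k)} {C : (Fin n → k) →ₗ[k] (Fin m → k)}
    {A : (Fin n → k) →ₗ[k] (Fin n → k)} {B : (Fin l → k) →ₗ[k] (Fin n → k)}
    {D' : (Fin m → k) →ₗ[k] (Fin p → k)} {C' : (Fin n' → k) →ₗ[k] (Fin p → k)}
    {A' : (Fin n' → k) →ₗ[k] (Fin n' → k)} {B' : (Fin m → k) →ₗ[k] (Fin n' → k)}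
    (hF : F.Realizes D C A B) (hG : G.Realizes D' C' A' B') :
    (F.seq G).Realizes (D' ∘ₗ D) (D' ∘ₗ C ∘ₗ fstL k n n' + C' ∘ₗ sndL k n n')
      (pairL (A ∘ₗ fstL k n n') ((B' ∘ₗ C) ∘ₗ fstL k n n' + A' ∘ₗ sndL k n n'))
      (pairL B (B' ∘ₗ D)) := by
  intro u x y z
  simp only [mem_seq, hF _ _ _ _, hG _ _ _ _, and_assoc, exists_eq_left, vec_ext_iff (x := z),
    map_add, fstL_pairL, sndL_pairL, LinearMap.add_apply, LinearMap.comp_apply, add_assoc]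
  tauto

theorem Realizes.sum {F : StateRel k n m p} {G : StateRel k n' m' p'}
    {D : (Fin m → k) →ₗ[k] (Fin p → k)} {C : (Fin n → k) →ₗ[k] (Fin p → k)}
    {A : (Fin n → k) →ₗ[k] (Fin n → k)} {B : (Fin m → k) →ₗ[k] (Fin n → k)}
    {D' : (Fin m' → k) →ₗ[k] (Fin p' → k)} {C' : (Fin n' → k) →ₗ[k] (Fin p' → k)}
    {A' : (Fin n' → k) →ₗ[k] (Fin n' → k)} {B' : (Fin m' → k) →ₗ[k] (Fin n' → k)}
    (hF : F.Realizes D C A B) (hG : G.Realizes D' C' A' B') :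
    (F.sum G).Realizes (sumL D D') (sumL C C') (sumL A A') (sumL B B') := by
  intro u x y z
  simp only [mem_sum, hF _ _ _ _, hG _ _ _ _, vec_ext_iff (x := z), vec_ext_iff (x := y),
    map_add, sumL, fstL_pairL, sndL_pairL, LinearMap.comp_apply]
  tauto

/-- A change of state coordinates `σ` replaces `C`, `A`, `B` by `C σ⁻¹`, `σ A σ⁻¹`, `σ B` and leaves
`D` alone. -/
theorem Realizes.of_equiv {F : StateRel k n m p} {G : StateRel k n' m p}
    {D : (Fin m → k) →ₗ[k] (Fin p → k)} {C : (Fin n → k) →ₗ[k] (Fin p → k)}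
    {A : (Fin n → k) →ₗ[k] (Fin n → k)} {B : (Fin m → k) →ₗ[k] (Fin n → k)}
    (hF : F.Realizes D C A B) (h : Equiv rfl rfl F G) :
    ∃ C' A' B', G.Realizes D C' A' B' ∧ statefulHom D C A B = statefulHom D C' A' B' := by
  obtain ⟨σ, h⟩ := h
  refine ⟨C ∘ₗ σ.symm.toLinearMap, σ.toLinearMap ∘ₗ A ∘ₗ σ.symm.toLinearMap, σ.toLinearMap ∘ₗ B,
    fun u x y z => ?_, ?_⟩
  · have := h u (σ.symm x) y (σ.symm z)
    simp only [castL_rfl, LinearEquiv.apply_symm_apply] at this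
    rw [← this, hF, σ.symm_apply_eq]
    simp
  · have hσ : extend σ.symm.toLinearMap ∘ₗ extend σ.toLinearMap = LinearMap.id := by
      rw [← extend_comp, ← extend_id]
      congr 1
      ext1; simp
    have hσ' : extend σ.toLinearMap ∘ₗ extend σ.symm.toLinearMap = LinearMap.id := by
      rw [← extend_comp, ← extend_id]
      congr 1
      ext1; simp
    have e (v) : extend σ.symm.toLinearMap (extend σ.toLinearMap v) = v :=
      LinearMap.congr_fun hσ v
    let τ : (Fin n → RatFunc k) ≃ₗ[RatFunc k] (Fin n' → RatFunc k) := LinearEquiv.ofLinearMap (extend σ.toLinearMap) (extend σ.symm.toLinearMap) hσ' hσ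
    have hτ (v) : τ v = extend σ.toLinearMap v := rfl
    -- The extension of `σ` to `k(s)` serves as isomorphism of both the prestate and the state
    -- spaces. That the resolvent is conjugated follows from the unique solvability of the equation
    -- defining it.
    refine Square.sound (Square.rel_mk τ τ (fun _ => rfl) (fun v => ?_) (fun v => ?_) fun v => ?_)
    · rw [hτ, extend_comp, LinearMap.comp_apply, e]
    · refine (resolvent_unique _ ?_).symm
      rw [hτ, hτ, extend_comp, extend_comp, LinearMap.comp_apply, LinearMap.comp_apply, e,
        ← map_smul, ← map_sub, resolvent_apply]
    · rw [hτ, extend_comp, LinearMap.comp_apply]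

theorem Realizes.unique {F : StateRel k n m p}
    {D D' : (Fin m → k) →ₗ[k] (Fin p → k)} {C C' : (Fin n → k) →ₗ[k] (Fin p → k)}
    {A A' : (Fin n → k) →ₗ[k] (Fin n → k)} {B B' : (Fin m → k) →ₗ[k] (Fin n → k)}
    (h : F.Realizes D C A B) (h' : F.Realizes D' C' A' B') :
    D = D' ∧ C = C' ∧ A = A' ∧ B = B' := by
  have key (u x) := (h' u x _ _).1 ((h u x _ _).2 ⟨rfl, rfl⟩)
  refine ⟨LinearMap.ext fun u => ?_, LinearMap.ext fun x => ?_, LinearMap.ext fun x => ?_,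
    LinearMap.ext fun u => ?_⟩
  · simpa using (key u 0).1
  · simpa using (key 0 x).1
  · simpa using (key 0 x).2
  · simpa using (key u 0).2

/-- This is what makes `lozenge` well defined: it is applied to the behaviours of two terms denoting
the same diagram. -/
theorem Realizes.statefulHom_eq {F : StateRel k n m p} {G : StateRel k n' m p}
    {D D' : (Fin m → k) →ₗ[k] (Fin p → k)} {C : (Fin n → k) →ₗ[k] (Fin p → k)}
    {A : (Fin n → k) →ₗ[k] (Fin n → k)} {B : (Fin m → k) →ₗ[k] (Fin n → k)}
    {C' : (Fin n' → k) →ₗ[k] (Fin p → k)} {A' : (Fin n' → k) →ₗ[k] (Fin n' → k)}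
    {B' : (Fin m → k) →ₗ[k] (Fin n' → k)} (hF : F.Realizes D C A B)
    (hG : G.Realizes D' C' A' B') (h : Equiv rfl rfl F G) :
    statefulHom D C A B = statefulHom D' C' A' B' := by
  obtain ⟨C₁, A₁, B₁, h₁, e⟩ := hF.of_equiv h
  obtain ⟨rfl, rfl, rfl, rfl⟩ := h₁.unique hG
  exact e

/-- Over `k(s)` the behaviour becomes `y = D u + C x`, `s x = B u + A x`, and the resolvent gives
the only `x` solving the second equation. -/
theorem Realizes.run_iff {F : StateRel k n m p} {D : (Fin m → k) →ₗ[k] (Fin p → k)}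
    {C : (Fin n → k) →ₗ[k] (Fin p → k)} {A : (Fin n → k) →ₗ[k] (Fin n → k)}
    {B : (Fin m → k) →ₗ[k] (Fin n → k)} (h : F.Realizes D C A B) {u : Fin m → RatFunc k}
    {y : Fin p → RatFunc k} :
    F.Run u y ↔ y = extend D u + extend C (resolvent A (extend B u)) := by
  have hExt (x z) : F.Ext u x y z ↔
      y = extend D u + extend C x ∧ z = extend B u + extend A x := by
    rw [ratFunc_vec_ext (x := y), ratFunc_vec_ext (x := z), ← forall_and]
    simp only [Ext, h _ _ _ _, map_add, compLeft_extend]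
  simp only [Run, hExt]
  constructor
  · rintro ⟨x, hy, hx⟩
    rw [hy, resolvent_unique A (sub_eq_iff_eq_add.2 hx)]
  · exact fun hy => ⟨_, hy, sub_eq_iff_eq_add.1 (resolvent_apply A _)⟩

end StateRel

/-! ### Diagrams with linear extracted relations -/

theorem finRel_eq_graph_iff {m n : ℕ} {R : (FinRel k).Hom m n}
    {f : (Fin m → k) →ₗ[k] (Fin n → k)} :
    R = (graphHom k).map f ↔
      ∀ u w, (u, w) ∈ (show Submodule k _ from R) ↔ w = f u := by
  constructor
  · rintro rfl u w
    exact mem_graph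
  · intro h
    refine Submodule.ext fun ⟨u, w⟩ => ?_
    exact (h u w).trans mem_graph.symm

theorem Term.realizes_iff {m p : ℕ} {t : Term (GenInt k) m p} 
    {D : (Fin m → k) →ₗ[k] (Fin p → k)} {C : (Fin t.ints → k) →ₗ[k] (Fin p → k)}
    {A : (Fin t.ints → k) →ₗ[k] (Fin t.ints → k)} {B : (Fin m → k) →ₗ[k] (Fin t.ints → k)} : t.stateRel.Realizes D C A B ↔
      relA t = (graphHom k).map A ∧ relB t = (graphHom k).map B ∧
        relC t = (graphHom k).map C ∧ relD t.mk = (graphHom k).map D := by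
  rw [StateRel.realizes_iff, finRel_eq_graph_iff, finRel_eq_graph_iff, finRel_eq_graph_iff,
    finRel_eq_graph_iff]
  simp only [mem_relA, mem_relB, mem_relC, mem_relD]

theorem Term.realizes_id (n : ℕ) :
    (Term.id n : Term (GenInt k) n n).stateRel.Realizes LinearMap.id 0 0 0 :=
  StateRel.realizes_ofRel LinearMap.id

theorem Term.realizes_braid (m n : ℕ) :
    (Term.braid m n : Term (GenInt k) _ _).stateRel.Realizes (swapL k m n) 0 0 0 :=
  StateRel.realizes_ofRel (swapL k m n)

theorem mem_contFlowSet {m p : ℕ} {f : (SigFlowInt k).Hom m p} : f ∈ contFlowSet k m p ↔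
    ∃ t : Term (GenInt k) m p, t.mk = f ∧ ∃ D C A B, t.stateRel.Realizes D C A B := by
  refine exists_congr fun t => and_congr_right fun ht => ?_
  subst ht
  constructor
  · rintro ⟨⟨A, hA⟩, ⟨B, hB⟩, ⟨C, hC⟩, D, hD⟩
    exact ⟨D, C, A, B, Term.realizes_iff.2 ⟨hA, hB, hC, hD⟩⟩
  · rintro ⟨D, C, A, B, h⟩
    obtain ⟨hA, hB, hC, hD⟩ := Term.realizes_iff.1 h
    exact ⟨⟨A, hA⟩, ⟨B, hB⟩, ⟨C, hC⟩, D, hD⟩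

theorem Term.equiv_of_mk_eq {m p : ℕ} {t t' : Term (GenInt k) m p} (h : t.mk = t'.mk) :
    StateRel.Equiv rfl rfl t.stateRel t'.stateRel :=
  Term.Rel.stateRel_equiv (Quotient.exact (s := termSetoid (GenInt k) m p) h)

/-- Membership in `contFlowSet` provides a single good term for the diagram; transport along the
isomorphism of state spaces shows that every term denoting it is good. -/
theorem Term.exists_realizes {m p : ℕ} {t : Term (GenInt k) m p} (h : t.mk ∈ contFlowSet k m p) :
    ∃ D C A B, t.stateRel.Realizes D C A B := by
  obtain ⟨t', ht, D, C, A, B, h⟩ := mem_contFlowSet.1 h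
  obtain ⟨C', A', B', h', -⟩ := h.of_equiv (Term.equiv_of_mk_eq ht)
  exact ⟨D, C', A', B', h'⟩

theorem contFlowSet_isClosed (k : Type u) [Field k] :
    (SigFlowInt k).IsClosed (contFlowSet k) where
  id_mem n := mem_contFlowSet.2 ⟨.id n, rfl, _, _, _, _, Term.realizes_id n⟩
  braid_mem m n := mem_contFlowSet.2 ⟨.braid m n, rfl, _, _, _, _, Term.realizes_braid m n⟩
  comp_mem hf hg := by
    obtain ⟨t, rfl, _, _, _, _, h⟩ := mem_contFlowSet.1 hf
    obtain ⟨t', rfl, _, _, _, _, h'⟩ := mem_contFlowSet.1 hg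
    exact mem_contFlowSet.2 ⟨.comp t t', rfl, _, _, _, _, h.seq h'⟩
  tensor_mem hf hg := by
    obtain ⟨t, rfl, _, _, _, _, h⟩ := mem_contFlowSet.1 hf
    obtain ⟨t', rfl, _, _, _, _, h'⟩ := mem_contFlowSet.1 hg
    exact mem_contFlowSet.2 ⟨.tensor t t', rfl, _, _, _, _, h.sum h'⟩

/-! ### The stateful morphism of a diagram -/

/-- Quantifying over all terms for `f` makes the value unambiguous, so a choice of `g` is harmless
and any convenient term may be used to compute it. -/
theorem exists_statefulHom {m p : ℕ} (f : contFlowSet k m p) :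
    ∃ g : (Stateful k).Hom m p, ∀ (t : Term (GenInt k) m p) (_ : t.mk = f.1) (D C A B),
      t.stateRel.Realizes D C A B → g.1 = statefulHom D C A B := by
  obtain ⟨t, ht, D, C, A, B, h⟩ := mem_contFlowSet.1 f.2
  exact ⟨⟨statefulHom D C A B, _, A, B, C, D, rfl⟩, fun t' ht' D' C' A' B' h' =>
    h.statefulHom_eq h' (Term.equiv_of_mk_eq (ht.trans ht'.symm))⟩

/-- The stateful morphism `(D(f), C(f), (s I - A(f))⁻¹, B(f))` of a diagram `f` whose extracted
relations are linear maps. -/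
def lozengeMap {m p : ℕ} (f : contFlowSet k m p) : (Stateful k).Hom m p :=
  (exists_statefulHom f).choose

theorem lozengeMap_eq {m p : ℕ} {f : contFlowSet k m p} {t : Term (GenInt k) m p}
    (ht : t.mk = f.1) {D : (Fin m → k) →ₗ[k] (Fin p → k)}
    {C : (Fin t.ints → k) →ₗ[k] (Fin p → k)} {A : (Fin t.ints → k) →ₗ[k] (Fin t.ints → k)}
    {B : (Fin m → k) →ₗ[k] (Fin t.ints → k)} (h : t.stateRel.Realizes D C A B) :
    (lozengeMap f).1 = statefulHom D C A B :=
  (exists_statefulHom f).choose_spec t ht D C A B h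

/-- The assignment of stateful morphisms to diagrams, as a morphism of PROPs. -/
def lozenge (k : Type u) [Field k] :
    PROPHom ((SigFlowInt k).sub (contFlowSet k) (contFlowSet_isClosed k)) (Stateful k) where
  map := lozengeMap
  map_id n := Subtype.ext <| by
    refine (lozengeMap_eq (t := .id n) rfl (Term.realizes_id n)).trans ?_
    exact (statefulHom_ofLinear _).trans (by rw [extend_id]; rfl)
  map_braid m n := Subtype.ext <| by
    refine (lozengeMap_eq (t := .braid m n) rfl (Term.realizes_braid m n)).trans ?_
    exact (statefulHom_ofLinear _).trans (by rw [extend_swapL]; rfl)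
  map_comp f g := Subtype.ext <| by
    obtain ⟨t, ht, D, C, A, B, h⟩ := mem_contFlowSet.1 f.2
    obtain ⟨t', ht', D', C', A', B', h'⟩ := mem_contFlowSet.1 g.2
    refine (lozengeMap_eq (f := ((SigFlowInt k).sub _ (contFlowSet_isClosed k)).comp f g)
      (t := .comp t t') (congrArg₂ FreeHom.comp ht ht') (h.seq h')).trans ?_
    refine (statefulHom_comp D C A B D' C' A' B').symm.trans ?_
    rw [← lozengeMap_eq ht h, ← lozengeMap_eq ht' h']
    rfl
  map_tensor f g := Subtype.ext <| by
    obtain ⟨t, ht, D, C, A, B, h⟩ := mem_contFlowSet.1 f.2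
    obtain ⟨t', ht', D', C', A', B', h'⟩ := mem_contFlowSet.1 g.2
    refine (lozengeMap_eq (f := ((SigFlowInt k).sub _ (contFlowSet_isClosed k)).tensor f g)
      (t := .tensor t t') (congrArg₂ FreeHom.tensor ht ht') (h.sum h')).trans ?_
    refine (statefulHom_tensor D C A B D' C' A' B').symm.trans ?_
    rw [← lozengeMap_eq ht h, ← lozengeMap_eq ht' h']
    rfl

theorem Term.blackBox_eq_graph {m p : ℕ} {t : Term (GenInt k) m p}
    {D : (Fin m → k) →ₗ[k] (Fin p → k)} {C : (Fin t.ints → k) →ₗ[k] (Fin p → k)}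
    {A : (Fin t.ints → k) →ₗ[k] (Fin t.ints → k)} {B : (Fin m → k) →ₗ[k] (Fin t.ints → k)}
    (h : t.stateRel.Realizes D C A B) :
    (blackBox k).map t.mk =
      (graphHom (RatFunc k)).map (extend D + extend C ∘ₗ resolvent A ∘ₗ extend B) :=
  finRel_eq_graph_iff.2 fun _ _ => t.mem_blackBox.trans h.run_iff

theorem incl_trans_blackBox (k : Type u) [Field k] :
    ((SigFlowInt k).incl (contFlowSet k) (contFlowSet_isClosed k)).trans (blackBox k) =
      (lozenge k).trans ((statefulEval k).trans (graphHom (RatFunc k))) := by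
  refine PROPHom.ext ?_
  funext m p f
  obtain ⟨t, ht, D, C, A, B, h⟩ := mem_contFlowSet.1 f.2
  refine (congrArg (blackBox k).map ht).symm.trans ((Term.blackBox_eq_graph h).trans ?_)
  refine congrArg (graphHom (RatFunc k)).map ?_
  -- On the chosen representative square, evaluation unfolds definitionally to `D + C (s I - A)⁻¹
  -- B`.
  exact (congrArg (boxEval (RatFunc k)).map (lozengeMap_eq ht h)).symm

end

end SignalFlow

theorem theorem5p7 (k : Type u) [Field k] :
    ∃ h : (SignalFlow.SigFlowInt k).IsClosed (SignalFlow.contFlowSet k),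
      ∃ loz : SignalFlow.PROPHom
          ((SignalFlow.SigFlowInt k).sub (SignalFlow.contFlowSet k) h) (SignalFlow.Stateful k),
        (∀ (m p : ℕ) (t : SignalFlow.Term (SignalFlow.GenInt k) m p)
          (ht : t.mk ∈ SignalFlow.contFlowSet k m p),
          ∃ (A : (SignalFlow.FinVect k).Hom t.ints t.ints) (B : (SignalFlow.FinVect k).Hom m t.ints)
            (C : (SignalFlow.FinVect k).Hom t.ints p) (D : (SignalFlow.FinVect k).Hom m p),
            SignalFlow.relA t = (SignalFlow.graphHom k).map A ∧
            SignalFlow.relB t = (SignalFlow.graphHom k).map B ∧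
            SignalFlow.relC t = (SignalFlow.graphHom k).map C ∧
            SignalFlow.relD (k := k) t.mk = (SignalFlow.graphHom k).map D ∧
            (loz.map ⟨t.mk, ht⟩).1 = SignalFlow.statefulHom D C A B ∧
            (SignalFlow.blackBox k).map t.mk =
              (SignalFlow.graphHom (RatFunc k)).map
                (SignalFlow.extend D +
                  SignalFlow.extend C ∘ₗ SignalFlow.resolvent A ∘ₗ SignalFlow.extend B)) ∧
        ((SignalFlow.SigFlowInt k).incl (SignalFlow.contFlowSet k) h).trans
            (SignalFlow.blackBox k) =
          loz.trans ((SignalFlow.statefulEval k).trans (SignalFlow.graphHom (RatFunc k))) := by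
  refine ⟨SignalFlow.contFlowSet_isClosed k, SignalFlow.lozenge k, fun m p t ht => ?_,
    SignalFlow.incl_trans_blackBox k⟩
  -- The claim concerns the given term `t`, not merely some term denoting the same diagram.
  obtain ⟨D, C, A, B, h⟩ := SignalFlow.Term.exists_realizes ht
  obtain ⟨hA, hB, hC, hD⟩ := SignalFlow.Term.realizes_iff.1 h
  exact ⟨A, B, C, D, hA, hB, hC, hD, SignalFlow.lozengeMap_eq rfl h,
    SignalFlow.Term.blackBox_eq_graph h⟩
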